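/- Let $m\ge 1$ and $n\ge 2$ be integers, and let $\mathcal H_{m,n}=L^2(\mathrm{Mat}_{\mathbb R}^{m,n},\mathbb C)$ be the Hilbert space of square-integrable functions of a real $m\times n$ matrix $X=(x_{i,j})$ (with respect to Lebesgue measure). For $1\le i\le m$ and $1\le j\le n$ let $\hat a_{i,j}f=\frac1{\sqrt2}\bigl(x_{i,j}f+\partial f/\partial x_{i,j}\bigr)$ be the annihilation operator on Schwartz functions, and let $\hat a_{i,j}^*$ be its adjoint. For $1\le j,k\le n$ let $\hat v_{j,k}$ be the closure of the operator $\sum_{i=1}^m(\hat a_{i,k}^*\hat a_{i,j}-\hat a_{i,j}^*\hat a_{i,k})$ on Schwartz functions. For $1\le k\le n-1$ put $\hat r_k=\arctan(\sqrt k)\,\hat v_{k,k+1}$, $\hat R_k=\exp(\hat r_k)$ and $\hat R=\hat R_{n-1}\hat R_{n-2}\cdots\hat R_1$, where $\exp(\hat r_k)$ is the value at time $1$ of the strongly continuous one-parameter unitary group with generator $\hat r_k$. Define, on its natural domain, $$\hat T_{\rm inv}=\sum_{k=1}^{n-1}\hat R^*\hat v_{k,n}\hat v_{k,n}^*\hat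 R,\qquad \mathcal K_0=\{f\in\operatorname{dom}\hat T_{\rm inv}\mid\langle f,\hat T_{\rm inv}f\rangle\le 0\}.$$ **Theorem.** Each $\hat r_k$ generates a strongly continuous one-parameter unitary group (so that $\hat R$ is well defined), and $\mathcal K_0$ is the null space $\{f\in\operatorname{dom}\hat T_{\rm inv}\mid\hat T_{\rm inv}f=0\}$ of $\hat T_{\rm inv}$. Moreover, $\mathcal K_0$ is exactly the set of all $f\in\mathcal H_{m,n}$ that are mode-wisely rotationally invariant, i.e. such that $f(X)=f(Xe^A)$ for almost every $X$, for every real antisymmetric $n\times n$ matrix $A$. If $m=1$, then $\mathcal K_0$ is exactly the set of square-integrable radial functions, i.e. of the $f\in\mathcal H_{1,n}$ for which there is a function $g$ on $\mathbb R$ with $f(X)=g(\|X\|)$ for almost every $X$, where $\|\cdot\|$ is the Euclidean norm. -/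

import Mathlib

open MeasureTheory SchwartzMap
open scoped LineDeriv Matrix

noncomputable section

/-! ### Unbounded operators on a complex Hilbert space -/

section Operators

variable {H : Type*} [NormedAddCommGroup H] [InnerProductSpace ℂ H]

/-- The composition `S ∘ T` of two unbounded operators, on its natural domain
`{f ∈ dom T | T f ∈ dom S}`. -/
def opComp (S T : H →ₗ.[ℂ] H) : H →ₗ.[ℂ] H :=
  S.comp (T.domRestrict ((S.domain.comap T.toFun).map T.domain.subtype)) (by
    rintro ⟨x, hx, hT⟩
    obtain ⟨y, hy, rfl⟩ := hx
    exact hy)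

theorem mem_opComp_domain (S T : H →ₗ.[ℂ] H) (f : H) :
    f ∈ (opComp S T).domain ↔ ∃ h : f ∈ T.domain, T ⟨f, h⟩ ∈ S.domain := by
  constructor
  · rintro ⟨⟨y, hy, rfl⟩, _⟩
    exact ⟨y.2, hy⟩
  · rintro ⟨h, h'⟩
    exact ⟨⟨⟨f, h⟩, h', rfl⟩, h⟩

theorem opComp_apply (S T : H →ₗ.[ℂ] H) (f : H) (h : f ∈ (opComp S T).domain)
    (hT : f ∈ T.domain) (hS : T ⟨f, hT⟩ ∈ S.domain) :
    opComp S T ⟨f, h⟩ = S ⟨T ⟨f, hT⟩, hS⟩ := rfl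

/-- A bounded operator, regarded as an operator with domain the whole space. -/
def ofBounded (B : H →L[ℂ] H) : H →ₗ.[ℂ] H := (B : H →ₗ[ℂ] H).toPMap ⊤

variable [CompleteSpace H]

/-- `U` is a strongly continuous one-parameter unitary group whose infinitesimal generator is
`L`: a vector `f` belongs to the domain of `L`, with `L f = g`, if and only if `t ↦ U t f` has
derivative `g` at `t = 0`. In other words `U t = exp (t L)`. -/
structure IsUnitaryGroupOf (L : H →ₗ.[ℂ] H) (U : ℝ → unitary (H →L[ℂ] H)) : Prop where
  map_zero : U 0 = 1
  map_add : ∀ s t : ℝ, U (s + t) = U s * U t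
  continuous : ∀ f : H, Continuous fun t : ℝ => (U t : H →L[ℂ] H) f
  generator : ∀ f g : H,
    (f, g) ∈ L.graph ↔ HasDerivAt (fun t : ℝ => (U t : H →L[ℂ] H) f) g 0

open Classical in
/-- The unitary operator `exp L` of a (generally unbounded) operator `L` that generates a strongly
continuous one-parameter unitary group, that is, of a skew-adjoint operator. (The value `1` is
used for an `L` that generates no such group.) -/
def unitaryExp (L : H →ₗ.[ℂ] H) : unitary (H →L[ℂ] H) :=
  if h : ∃ U : ℝ → unitary (H →L[ℂ] H), IsUnitaryGroupOf L U then h.choose 1 else 1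

end Operators

/-! ### Real matrices and functions of a real matrix variable -/

/-- The space of real `m × n` matrices `X = (x_{i,j})` with the Frobenius norm
`‖X‖² = ∑ x_{i,j}²` and with Lebesgue measure. -/
abbrev MatSpace (m n : ℕ) : Type := EuclideanSpace ℝ (Fin m × Fin n)

namespace MatSpace

/-- The matrix with the given entries. -/
def toMatrix {m n : ℕ} (X : MatSpace m n) : Matrix (Fin m) (Fin n) ℝ :=
  Matrix.of fun i j => X (i, j)

/-- The matrix product `X ↦ X B`. -/
def mulRight {m n : ℕ} (X : MatSpace m n) (B : Matrix (Fin n) (Fin n) ℝ) : MatSpace m n :=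
  WithLp.toLp 2 fun p => (X.toMatrix * B) p.1 p.2

end MatSpace

/-- The Hilbert space of square-integrable functions of a real `m × n` matrix, canonically the
`mn`-fold Hilbert tensor power of `L²(ℝ)`. -/
abbrev HilbertMN (m n : ℕ) : Type := Lp ℂ 2 (volume : Measure (MatSpace m n))

/-! ### Annihilation operators and the operators built from them -/

section Modes

variable {m n : ℕ}

/-- The operator `f ↦ (x_{i,j} f + ∂f/∂x_{i,j}) / √2` on Schwartz functions. -/
def annihilationSchwartz (i : Fin m) (j : Fin n) :
    𝓢(MatSpace m n, ℂ) →ₗ[ℂ] 𝓢(MatSpace m n, ℂ) :=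
  ((Real.sqrt 2 : ℝ) : ℂ)⁻¹ •
    ((smulLeftCLM ℂ (fun X : MatSpace m n => ((X (i, j) : ℝ) : ℂ))).toLinearMap +
      (LineDeriv.lineDerivOpCLM ℂ 𝓢(MatSpace m n, ℂ)
        (EuclideanSpace.single (i, j) (1 : ℝ))).toLinearMap)

theorem annihilationSchwartz_apply (i : Fin m) (j : Fin n) (f : 𝓢(MatSpace m n, ℂ))
    (X : MatSpace m n) :
    annihilationSchwartz i j f X =
      (X (i, j) * f X + lineDeriv ℝ f X (EuclideanSpace.single (i, j) 1)) / Real.sqrt 2 := by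
  have h : (fun X : MatSpace m n => ((X (i, j) : ℝ) : ℂ)).HasTemperateGrowth := by
    have : (fun X : MatSpace m n => ((X (i, j) : ℝ) : ℂ)) =
        (Complex.ofRealCLM ∘L (EuclideanSpace.proj (i, j) : MatSpace m n →L[ℝ] ℝ)) := by
      ext X; simp
    rw [this]
    exact ContinuousLinearMap.hasTemperateGrowth _
  simp only [annihilationSchwartz, LinearMap.smul_apply, LinearMap.add_apply,
    ContinuousLinearMap.coe_coe, _root_.smul_apply, _root_.add_apply,
    smulLeftCLM_apply_apply h, smul_eq_mul, LineDeriv.lineDerivOpCLM_apply,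
    SchwartzMap.lineDerivOp_apply]
  rw [div_eq_inv_mul]

/-- The inclusion of Schwartz functions into `L²`. -/
def schwartzToL2 (m n : ℕ) : 𝓢(MatSpace m n, ℂ) →ₗ[ℂ] HilbertMN m n :=
  (toLpCLM ℂ ℂ 2 (volume : Measure (MatSpace m n))).toLinearMap

theorem schwartzToL2_injective (m n : ℕ) : Function.Injective (schwartzToL2 m n) :=
  injective_toLp 2 (volume : Measure (MatSpace m n))

/-- The annihilation operator `a_{i,j}`, densely defined on Schwartz functions by
`a_{i,j} f = (x_{i,j} f + ∂f/∂x_{i,j}) / √2`. -/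
def annihilation (i : Fin m) (j : Fin n) : HilbertMN m n →ₗ.[ℂ] HilbertMN m n where
  domain := LinearMap.range (schwartzToL2 m n)
  toFun := schwartzToL2 m n ∘ₗ annihilationSchwartz i j ∘ₗ
    (LinearEquiv.ofInjective (schwartzToL2 m n) (schwartzToL2_injective m n)).symm.toLinearMap

theorem annihilation_apply (i : Fin m) (j : Fin n) (f : 𝓢(MatSpace m n, ℂ)) :
    annihilation i j ⟨schwartzToL2 m n f, f, rfl⟩ =
      schwartzToL2 m n (annihilationSchwartz i j f) := by
  have : (LinearEquiv.ofInjective (schwartzToL2 m n) (schwartzToL2_injective m n)).symm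
      ⟨schwartzToL2 m n f, f, rfl⟩ = f := by
    rw [LinearEquiv.symm_apply_eq]; rfl
  exact congrArg (fun g => schwartzToL2 m n (annihilationSchwartz i j g)) this

/-- The closed operator `v_{j,k} = ∑ᵢ (a_{i,k}^* a_{i,j} - a_{i,j}^* a_{i,k})`: the closure of the
differential operator given by this formula on Schwartz functions. -/
def vOp (j k : Fin n) : HilbertMN m n →ₗ.[ℂ] HilbertMN m n :=
  (∑ i : Fin m,
    (opComp (annihilation i k).adjoint (annihilation i j) -
      opComp (annihilation i j).adjoint (annihilation i k))).closure

end Modes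

section Tinv

variable (m n : ℕ)

/-- The operators `r_1, …, r_{n-1}`, where `r_k = arctan(√k) v_{k,k+1}`. The index `k` of `Fin`
stands for the number `k + 1`, since the rows and columns are counted from `0`. -/
def rOp (k : Fin (n - 1)) : HilbertMN m n →ₗ.[ℂ] HilbertMN m n :=
  ((Real.arctan (Real.sqrt ((k : ℝ) + 1)) : ℝ) : ℂ) •
    vOp ⟨k.1, by have := k.2; omega⟩ ⟨k.1 + 1, by have := k.2; omega⟩

/-- The unitary operator `R = R_{n-1} R_{n-2} ⋯ R_1`, where `R_k = exp r_k`. -/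
def ROp : unitary (HilbertMN m n →L[ℂ] HilbertMN m n) :=
  (List.ofFn fun k : Fin (n - 1) => unitaryExp (rOp m n k)).reverse.prod

/-- The operators `v_{1,n}, …, v_{n-1,n}`. -/
def vLast (k : Fin (n - 1)) : HilbertMN m n →ₗ.[ℂ] HilbertMN m n :=
  vOp ⟨k.1, by have := k.2; omega⟩ ⟨n - 1, by have := k.2; omega⟩

/-- The observable `T_inv = ∑_{k=1}^{n-1} R^* v_{k,n} v_{k,n}^* R`. -/
def TInv : HilbertMN m n →ₗ.[ℂ] HilbertMN m n :=
  ∑ k : Fin (n - 1),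
    opComp (ofBounded (star (ROp m n) : HilbertMN m n →L[ℂ] HilbertMN m n))
      (opComp (vLast m n k)
        (opComp (vLast m n k).adjoint
          (ofBounded (ROp m n : HilbertMN m n →L[ℂ] HilbertMN m n))))

/-- The set `K_t` of the vectors `f` with `⟨f, T_inv f⟩ ≤ t ‖f‖²`. -/
def KSet (t : ℝ) : Set (HilbertMN m n) :=
  {f | ∃ h : f ∈ (TInv m n).domain, (inner ℂ f (TInv m n ⟨f, h⟩)).re ≤ t * ‖f‖ ^ 2}

/-- The null space `{f ∈ dom L | L f = 0}` of an operator. -/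
def nullSpace {m n : ℕ} (L : HilbertMN m n →ₗ.[ℂ] HilbertMN m n) : Set (HilbertMN m n) :=
  {f | ∃ h : f ∈ L.domain, L ⟨f, h⟩ = 0}

end Tinv

section Invariance

variable {m n : ℕ}

/-- A square-integrable function `f` is mode-wisely rotationally invariant if, for every real
antisymmetric matrix `A`, the functions `X ↦ f(X)` and `X ↦ f(X e^A)` are equal (as elements of
`L²`, that is, almost everywhere). -/
def IsMwRI (f : HilbertMN m n) : Prop :=
  ∀ A : Matrix (Fin n) (Fin n) ℝ, Aᵀ = -A →
    ∀ᵐ X : MatSpace m n, f X = f (X.mulRight (NormedSpace.exp A))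

/-- A square-integrable function is radial if `f(X) = g(‖X‖)` for some function `g` of a real
variable. -/
def IsRadial (f : HilbertMN m n) : Prop :=
  ∃ g : ℝ → ℂ, ∀ᵐ X : MatSpace m n, f X = g ‖X‖

end Invariance

end

/-! On Schwartz functions the second-order and multiplication terms in `v_{j,k}` cancel, and what
remains is the derivative along the linear field `X ↦ X G` with `G = rotationGenerator j k`
antisymmetric. Schwartz functions are dense and invariant under the rotations `f(X) ↦ f(X e^{tG})`,
hence a core of the generator (`HasInvariantCore.generatorGraph_eq`). So the closure `v_{j,k}` is
exactly that generator (`vOp_graph`), each `r_k` generates a rotation group, and `R` is a product of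
rotations.

On the domain of `T_inv` one has `⟨f, T_inv f⟩ = ∑ ‖v_{k,n}^* R f‖²`. If this is at most `0`, then
`R f` is orthogonal to the range of every `v_{k,n}`. Since `[v_{j,n}, v_{k,n}] = v_{j,k}` on
Schwartz functions, `R f` is then orthogonal to the image of the core under every rotation
generator, and such a vector is fixed by the rotations
(`HasInvariantCore.apply_eq_of_inner_eq_zero`). As `R` is a product of rotations, `R^*` fixes `R f`,
so `f = R^* R f = R f` is invariant. Conversely, an invariant `f` is fixed by `R` and annihilated by
each `v_{k,n}^*`. The angles `arctan √k` matter only through being nonzero.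

For `m = 1` and `n ≥ 2` the rotations are transitive on spheres. Averages over balls turn almost
everywhere invariance into invariance at every point, and Lebesgue differentiation recovers `f` from
them (`isMwRI_iff_isRadial`). -/

noncomputable section

/-! ### One-parameter unitary groups, their generators and cores -/

section UnitaryGroups

variable {H : Type*} [NormedAddCommGroup H] [InnerProductSpace ℂ H] [CompleteSpace H]

/-- A strongly continuous one-parameter unitary group. -/
structure IsUnitaryGroup (U : ℝ → unitary (H →L[ℂ] H)) : Prop where
  map_zero : U 0 = 1
  map_add : ∀ s t : ℝ, U (s + t) = U s * U t
  continuous : ∀ f : H, Continuous fun t : ℝ => (U t : H →L[ℂ] H) f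

theorem norm_unitary_apply (u : unitary (H →L[ℂ] H)) (f : H) : ‖(u : H →L[ℂ] H) f‖ = ‖f‖ :=
  (Unitary.linearIsometryEquiv u).norm_map f

/-- The graph of the generator of a one-parameter unitary group. -/
def generatorGraph (U : ℝ → unitary (H →L[ℂ] H)) : Submodule ℂ (H × H) where
  carrier := {p | HasDerivAt (fun t : ℝ => (U t : H →L[ℂ] H) p.1) p.2 0}
  add_mem' := by
    intro p q hp hq
    rw [Set.mem_ofPred_eq]
    convert! HasDerivAt.add hp hq using 1
    ext t; simp
  zero_mem' := by simpa using hasDerivAt_const (0 : ℝ) (0 : H)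
  smul_mem' := by
    intro c p hp
    rw [Set.mem_ofPred_eq]
    convert! HasDerivAt.const_smul c hp using 1
    ext t; simp

theorem mem_generatorGraph {U : ℝ → unitary (H →L[ℂ] H)} {f g : H} :
    (f, g) ∈ generatorGraph U ↔ HasDerivAt (fun t : ℝ => (U t : H →L[ℂ] H) f) g 0 := Iff.rfl

namespace IsUnitaryGroup

variable {U : ℝ → unitary (H →L[ℂ] H)}

theorem zero_apply (hU : IsUnitaryGroup U) (f : H) : (U 0 : H →L[ℂ] H) f = f := by
  rw [hU.map_zero]; rfl

theorem add_apply (hU : IsUnitaryGroup U) (s t : ℝ) (f : H) :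
    (U (s + t) : H →L[ℂ] H) f = (U s : H →L[ℂ] H) ((U t : H →L[ℂ] H) f) := by
  rw [hU.map_add]; rfl

theorem hasDerivAt (hU : IsUnitaryGroup U) {f g : H} (h : (f, g) ∈ generatorGraph U) (t : ℝ) :
    HasDerivAt (fun t : ℝ => (U t : H →L[ℂ] H) f) ((U t : H →L[ℂ] H) g) t := by
  have h0 : HasDerivAt (fun s : ℝ => (U s : H →L[ℂ] H) f) g (t - t) := by
    rwa [sub_self]
  have h1 := h0.comp_sub_const t t
  have h2 := ((U t : H →L[ℂ] H).restrictScalars ℝ).hasFDerivAt.comp_hasDerivAt t h1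
  refine h2.congr_of_eventuallyEq (Filter.Eventually.of_forall fun s => ?_)
  simp [← hU.add_apply]

theorem apply_mem_generatorGraph (hU : IsUnitaryGroup U) {f g : H} (h : (f, g) ∈ generatorGraph U) (t : ℝ) :
    ((U t : H →L[ℂ] H) f, (U t : H →L[ℂ] H) g) ∈ generatorGraph U := by
  rw [mem_generatorGraph]
  have h2 := ((U t : H →L[ℂ] H).restrictScalars ℝ).hasFDerivAt.comp_hasDerivAt 0 h
  refine h2.congr_of_eventuallyEq (Filter.Eventually.of_forall fun s => ?_)
  simp [← hU.add_apply, add_comm]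

theorem re_inner_eq_zero (hU : IsUnitaryGroup U) {f g : H} (h : (f, g) ∈ generatorGraph U) :
    (inner ℂ f g).re = 0 := by
  have h1 : HasDerivAt (fun t : ℝ => (U t : H →L[ℂ] H) f) g 0 := h
  have h2 := h1.inner ℂ h1
  have h3 : (fun t : ℝ => inner ℂ ((U t : H →L[ℂ] H) f) ((U t : H →L[ℂ] H) f)) =
      fun _ => inner ℂ f f := by
    funext t
    simp only [inner_self_eq_norm_sq_to_K, norm_unitary_apply]
  rw [h3] at h2
  have h4 := h2.unique (hasDerivAt_const (0 : ℝ) _)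
  rw [hU.zero_apply] at h4
  have h5 := congrArg Complex.re h4
  have h6 : (inner ℂ g f).re = (inner ℂ f g).re := inner_re_symm (𝕜 := ℂ) g f
  simp only [Complex.add_re, Complex.zero_re, h6] at h5
  linarith

/-- The inner product of `f` and `g` is imaginary, so `‖f - g‖² = ‖f‖² + ‖g‖²`. This bounds `1 - L`
from below for a generator `L`. -/
theorem norm_le_norm_sub (hU : IsUnitaryGroup U) {f g : H} (h : (f, g) ∈ generatorGraph U) : ‖f‖ ≤ ‖f - g‖ := by
  have h1 : ‖f - g‖ ^ 2 = ‖f‖ ^ 2 + ‖g‖ ^ 2 := by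
    have := norm_sub_sq (𝕜 := ℂ) f g
    have h2 := hU.re_inner_eq_zero h
    simp only [RCLike.re_to_complex] at this
    rw [this, h2]; ring
  exact le_of_sq_le_sq (by nlinarith [sq_nonneg ‖g‖]) (norm_nonneg _)

theorem mem_generatorGraph_of_norm_le (hU : IsUnitaryGroup U) {f g : H} {C : ℝ}
    (h : ∀ t : ℝ, ‖(U t : H →L[ℂ] H) f - f - (t : ℂ) • g‖ ≤ t ^ 2 * C) :
    (f, g) ∈ generatorGraph U := by
  rw [mem_generatorGraph, hasDerivAt_iff_isLittleO]
  have hO : (fun t : ℝ => (U t : H →L[ℂ] H) f - (U 0 : H →L[ℂ] H) f - (t - 0) • g)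
      =O[nhds 0] fun t : ℝ => t ^ 2 := by
    refine Asymptotics.IsBigO.of_bound C (Filter.Eventually.of_forall fun t => ?_)
    rw [Real.norm_eq_abs, abs_of_nonneg (sq_nonneg t), mul_comm, hU.zero_apply, sub_zero]
    exact h t
  refine hO.trans_isLittleO ?_
  simpa using (Asymptotics.isLittleO_pow_id (𝕜 := ℝ) (n := 2) (by norm_num))

/-- The integrated form of the differential equation involves only operations continuous in `f` and
`g`, which makes the graph closed. -/
theorem mem_generatorGraph_iff_integral (hU : IsUnitaryGroup U) {f g : H} :
    (f, g) ∈ generatorGraph U ↔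
      ∀ t : ℝ, ∫ s in (0 : ℝ)..t, (U s : H →L[ℂ] H) g = (U t : H →L[ℂ] H) f - f := by
  constructor
  · intro h t
    rw [intervalIntegral.integral_eq_sub_of_hasDerivAt (fun s _ => hU.hasDerivAt h s)
      ((hU.continuous g).intervalIntegrable _ _), hU.zero_apply]
  · intro h
    have h1 : HasDerivAt (fun t : ℝ => ∫ s in (0 : ℝ)..t, (U s : H →L[ℂ] H) g)
        ((U 0 : H →L[ℂ] H) g) 0 := (hU.continuous g).integral_hasStrictDerivAt 0 0 |>.hasDerivAt
    simp only [h, hU.zero_apply] at h1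
    simpa [mem_generatorGraph] using h1.add_const f

theorem isClosed_generatorGraph (hU : IsUnitaryGroup U) : IsClosed (generatorGraph U : Set (H × H)) := by
  have h1 : (generatorGraph U : Set (H × H)) = ⋂ t : ℝ,
      {p | ∫ s in (0 : ℝ)..t, (U s : H →L[ℂ] H) p.2 = (U t : H →L[ℂ] H) p.1 - p.1} := by
    ext p
    simpa using hU.mem_generatorGraph_iff_integral (f := p.1) (g := p.2)
  rw [h1]
  refine isClosed_iInter fun t => isClosed_eq ?_ (by fun_prop)
  have h2 : LipschitzWith ⟨|t|, abs_nonneg t⟩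
      fun g : H => ∫ s in (0 : ℝ)..t, (U s : H →L[ℂ] H) g := by
    refine LipschitzWith.of_dist_le_mul fun g g' => ?_
    rw [dist_eq_norm, dist_eq_norm, ← intervalIntegral.integral_sub
      ((hU.continuous g).intervalIntegrable _ _) ((hU.continuous g').intervalIntegrable _ _)]
    refine (intervalIntegral.norm_integral_le_of_norm_le_const (C := ‖g - g'‖) fun s _ => ?_).trans ?_
    · rw [← map_sub, norm_unitary_apply]
    · simp only [sub_zero]
      exact (mul_comm _ _).le
  exact h2.continuous.comp continuous_snd

/-- A group is determined by the graph of its generator. -/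
theorem eq_of_generatorGraph_eq (hU : IsUnitaryGroup U) {V : ℝ → unitary (H →L[ℂ] H)} (hV : IsUnitaryGroup V)
    (h : generatorGraph U = generatorGraph V)
    (hd : Dense {f : H | ∃ g, (f, g) ∈ generatorGraph U}) : U = V := by
  have key : ∀ f g, (f, g) ∈ generatorGraph U →
      ∀ t, (U t : H →L[ℂ] H) f = (V t : H →L[ℂ] H) f := by
    intro f g hfg t
    have hfg' : (f, g) ∈ generatorGraph V := h ▸ hfg
    -- The difference of the two orbits stays in the domain of the common generator, so its norm is
    -- constant, and it vanishes at time `0`.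
    set w : ℝ → H := fun t => (U t : H →L[ℂ] H) f - (V t : H →L[ℂ] H) f with hw
    have hd : ∀ t, HasDerivAt w ((U t : H →L[ℂ] H) g - (V t : H →L[ℂ] H) g) t := fun t =>
      (hU.hasDerivAt hfg t).sub (hV.hasDerivAt hfg' t)
    have hr : ∀ t, (inner ℂ (w t) ((U t : H →L[ℂ] H) g - (V t : H →L[ℂ] H) g)).re = 0 := by
      intro t
      refine hU.re_inner_eq_zero ?_
      have h1 := hU.apply_mem_generatorGraph hfg t
      have h2 := hV.apply_mem_generatorGraph hfg' t
      rw [← h] at h2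
      exact sub_mem h1 h2
    have hn : ∀ t, HasDerivAt (fun t => (inner ℂ (w t) (w t)).re) 0 t := by
      intro t
      have h1 := Complex.reCLM.hasFDerivAt.comp_hasDerivAt t ((hd t).inner ℂ (hd t))
      have h6 := inner_re_symm (𝕜 := ℂ) ((U t : H →L[ℂ] H) g - (V t : H →L[ℂ] H) g) (w t)
      simp only [RCLike.re_to_complex] at h6
      simpa [Function.comp_def, h6, hr t] using h1
    have hc := is_const_of_deriv_eq_zero (fun t => (hn t).differentiableAt)
      (fun t => (hn t).deriv) t 0
    have h0 : w 0 = 0 := by simp [hw, hU.zero_apply, hV.zero_apply]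
    rw [h0] at hc
    have h7 : w t = 0 := by
      rw [← inner_self_eq_zero (𝕜 := ℂ)]
      have h8 := inner_self_im (𝕜 := ℂ) (w t)
      simp only [RCLike.im_to_complex] at h8
      exact Complex.ext (by simpa using hc) (by simpa using h8)
    exact sub_eq_zero.1 h7
  funext t
  refine Subtype.ext (ContinuousLinearMap.ext fun f => ?_)
  refine congrFun (Continuous.ext_on hd (U t : H →L[ℂ] H).continuous
    (V t : H →L[ℂ] H).continuous ?_) f
  rintro f ⟨g, hg⟩
  exact key f g hg t

theorem isUnitaryGroupOf (hU : IsUnitaryGroup U) {L : H →ₗ.[ℂ] H} (h : L.graph = generatorGraph U) :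
    IsUnitaryGroupOf L U :=
  ⟨hU.map_zero, hU.map_add, hU.continuous, fun f g => by rw [h]; rfl⟩

/-- The group chosen in `unitaryExp` must be `U`, because a densely defined generator determines its
group. -/
theorem unitaryExp_eq (hU : IsUnitaryGroup U) {L : H →ₗ.[ℂ] H} (h : L.graph = generatorGraph U)
    (hd : Dense (L.domain : Set H)) : unitaryExp L = U 1 := by
  have hex : ∃ U : ℝ → unitary (H →L[ℂ] H), IsUnitaryGroupOf L U := ⟨U, hU.isUnitaryGroupOf h⟩
  rw [unitaryExp, dif_pos hex]
  obtain ⟨h0, ha, hc, hg⟩ := hex.choose_spec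
  have hV : generatorGraph hex.choose = L.graph := by
    ext ⟨f, g⟩
    exact (hg f g).symm
  refine congrFun (IsUnitaryGroup.eq_of_generatorGraph_eq ⟨h0, ha, hc⟩ hU (hV.trans h) ?_) 1
  rw [hV]
  refine hd.mono fun f hf => ?_
  exact LinearPMap.mem_domain_iff.1 hf

theorem comp_const_mul (hU : IsUnitaryGroup U) (c : ℝ) : IsUnitaryGroup fun t => U (c * t) where
  map_zero := by simpa using hU.map_zero
  map_add s t := by rw [mul_add, hU.map_add]
  continuous f := (hU.continuous f).comp (continuous_const.mul continuous_id)

/-- The case `c = 0` is excluded: `0 • L` keeps the domain of `L`, whereas the trivial group has a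
generator defined everywhere. -/
theorem smul_graph_eq {L : H →ₗ.[ℂ] H} (h : L.graph = generatorGraph U) {c : ℝ} (hc : c ≠ 0) :
    ((c : ℂ) • L).graph = generatorGraph fun t => U (c * t) := by
  have hc' : (c : ℂ) ≠ 0 := by exact_mod_cast hc
  have scale : ∀ (W : ℝ → unitary (H →L[ℂ] H)) (d : ℝ) (f g : H), (f, g) ∈ generatorGraph W →
      (f, (d : ℂ) • g) ∈ generatorGraph fun t => W (d * t) := by
    intro W d f g hfg
    have h0 : HasDerivAt (fun s : ℝ => (W s : H →L[ℂ] H) f) g (d * 0) := by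
      rwa [mul_zero]
    have h1 := h0.scomp (0 : ℝ) ((hasDerivAt_id (0 : ℝ)).const_mul d)
    simpa [mem_generatorGraph, Function.comp_def] using h1
  ext ⟨f, g⟩
  have h1 : (f, g) ∈ ((c : ℂ) • L).graph ↔ (f, (c : ℂ)⁻¹ • g) ∈ L.graph := by
    simp only [LinearPMap.mem_graph_iff, LinearPMap.smul_apply]
    constructor
    · rintro ⟨y, hy, rfl⟩
      exact ⟨y, hy, by rw [smul_smul, inv_mul_cancel₀ hc', one_smul]⟩
    · rintro ⟨y, hy, h⟩
      exact ⟨y, hy, by rw [h, smul_smul, mul_inv_cancel₀ hc', one_smul]⟩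
  rw [h1, h]
  constructor
  · intro h2
    have := scale U c _ _ h2
    rwa [smul_smul, mul_inv_cancel₀ hc', one_smul] at this
  · intro h2
    have := scale _ c⁻¹ _ _ h2
    simpa [← mul_assoc, mul_inv_cancel₀ hc] using this

end IsUnitaryGroup

/-- An invariant dense space of differentiable vectors: `S` is mapped to `H` by `ι`, with dense
range, the group acts on `S` by `u`, and the generator acts on `S` by `L`. -/
structure HasInvariantCore {S : Type*} [AddCommGroup S] [Module ℂ S] (U : ℝ → unitary (H →L[ℂ] H))
    (ι : S →ₗ[ℂ] H) (u : ℝ → S → S) (L : S →ₗ[ℂ] S) : Prop where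
  denseRange : DenseRange ι
  intertwine : ∀ t φ, (U t : H →L[ℂ] H) (ι φ) = ι (u t φ)
  mem_graph : ∀ φ, (ι φ, ι (L φ)) ∈ generatorGraph U

namespace HasInvariantCore

variable {S : Type*} [AddCommGroup S] [Module ℂ S] {U : ℝ → unitary (H →L[ℂ] H)}
  {ι : S →ₗ[ℂ] H} {u : ℝ → S → S} {L : S →ₗ[ℂ] S}

theorem hasDerivAt (hU : IsUnitaryGroup U) (hC : HasInvariantCore U ι u L) (φ : S) (t : ℝ) :
    HasDerivAt (fun t => ι (u t φ)) (ι (L (u t φ))) t := by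
  have h0 : HasDerivAt (fun s : ℝ => (U s : H →L[ℂ] H) (ι (u t φ))) (ι (L (u t φ))) (t - t) := by
    rw [sub_self]
    exact hC.mem_graph (u t φ)
  have h1 := h0.comp_sub_const t t
  refine h1.congr_of_eventuallyEq (Filter.Eventually.of_forall fun s => ?_)
  simp [← hC.intertwine, ← hU.add_apply]

theorem hasDerivAt_inner (hU : IsUnitaryGroup U) (hC : HasInvariantCore U ι u L) (φ : S) (f : H)
    (t : ℝ) : HasDerivAt (fun t => inner ℂ f (ι (u t φ))) (inner ℂ f (ι (L (u t φ)))) t := by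
  simpa using (hasDerivAt_const t f).inner ℂ (hC.hasDerivAt hU φ t)

/-- A vector that annihilates the range of the generator on the core is invariant. -/
theorem apply_eq_of_inner_eq_zero (hU : IsUnitaryGroup U) (hC : HasInvariantCore U ι u L) {f : H}
    (h : ∀ φ, inner ℂ f (ι (L φ)) = 0) (t : ℝ) : (U t : H →L[ℂ] H) f = f := by
  have h1 : ∀ φ s, inner ℂ f ((U s : H →L[ℂ] H) (ι φ)) = inner ℂ f (ι φ) := by
    intro φ s
    have h2 := is_const_of_deriv_eq_zero (fun t => (hC.hasDerivAt_inner hU φ f t).differentiableAt)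
      (fun t => (hC.hasDerivAt_inner hU φ f t).deriv.trans (h _)) s 0
    simpa [← hC.intertwine, hU.zero_apply] using h2
  refine hC.denseRange.eq_of_inner_left ℂ fun φ => ?_
  -- Unitarity moves `U t` to the other side as `U (-t)`, where `h1` applies.
  have h2 := (Unitary.linearIsometryEquiv (U t)).inner_map_map f ((U (-t) : H →L[ℂ] H) (ι φ))
  rw [h1] at h2
  rw [← h2]
  change _ = inner ℂ ((U t : H →L[ℂ] H) f) ((U t : H →L[ℂ] H) ((U (-t) : H →L[ℂ] H) (ι φ)))
  rw [← hU.add_apply, add_neg_cancel, hU.zero_apply]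

/-- The range of `1 - L` on the core is dense. -/
theorem dense_range_sub (hU : IsUnitaryGroup U) (hC : HasInvariantCore U ι u L) :
    DenseRange (ι - ι ∘ₗ L) := by
  have h0 : (LinearMap.range (ι - ι ∘ₗ L)).topologicalClosure = ⊤ := by
    rw [Submodule.topologicalClosure_eq_top_iff, Submodule.eq_bot_iff]
    intro f hf
    have h1 : ∀ φ, inner ℂ f (ι (L φ)) = inner ℂ f (ι φ) := by
      intro φ
      have := Submodule.inner_left_of_mem_orthogonal (LinearMap.mem_range_self (ι - ι ∘ₗ L) φ) hf
      simp only [LinearMap.sub_apply, LinearMap.comp_apply, inner_sub_right] at this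
      exact (sub_eq_zero.1 this).symm
    have h2 : ∀ φ, inner ℂ f (ι φ) = 0 := by
      intro φ
      -- For `f` orthogonal to the range, `⟨f, U t φ⟩` solves `y' = y`, hence equals `e^t ⟨f, φ⟩`.
      -- It is bounded by unitarity, so letting `t → ∞` gives `⟨f, φ⟩ = 0`.
      have h3 : ∀ t : ℝ, HasDerivAt
          (fun t : ℝ => Complex.exp (-t) * inner ℂ f (ι (u t φ))) 0 t := by
        intro t
        have h4 : HasDerivAt (fun t : ℝ => Complex.exp (-t)) (-Complex.exp (-t)) t := by
          simpa using (((hasDerivAt_id (t : ℂ)).neg).cexp).comp_ofReal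
        refine (h4.mul (hC.hasDerivAt_inner hU φ f t)).congr_deriv ?_
        rw [h1]; ring
      have h5 : ∀ t : ℝ, ‖inner ℂ f (ι φ)‖ ≤ Real.exp (-t) * (‖f‖ * ‖ι φ‖) := by
        intro t
        have h6 := is_const_of_deriv_eq_zero (fun t => (h3 t).differentiableAt)
          (fun t => (h3 t).deriv) t 0
        simp only [← hC.intertwine, hU.zero_apply, Complex.ofReal_zero, neg_zero, Complex.exp_zero,
          one_mul] at h6
        rw [← h6, norm_mul, ← Complex.ofReal_neg, Complex.norm_exp_ofReal]
        gcongr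
        exact (norm_inner_le_norm _ _).trans (by rw [norm_unitary_apply])
      have h7 : Filter.Tendsto (fun t : ℝ => Real.exp (-t) * (‖f‖ * ‖ι φ‖)) Filter.atTop (nhds 0) := by
        simpa using (Real.tendsto_exp_neg_atTop_nhds_zero).mul_const (‖f‖ * ‖ι φ‖)
      exact norm_le_zero_iff.1 (ge_of_tendsto' h7 h5)
    exact hC.denseRange.eq_zero_of_inner_left ℂ (fun φ => h2 φ)
  intro x
  have : x ∈ (LinearMap.range (ι - ι ∘ₗ L)).topologicalClosure := h0 ▸ Submodule.mem_top
  exact this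

/-- The core determines the generator. -/
theorem generatorGraph_eq (hU : IsUnitaryGroup U) (hC : HasInvariantCore U ι u L) :
    (LinearMap.range (ι.prod (ι ∘ₗ L))).topologicalClosure = generatorGraph U := by
  apply le_antisymm
  · refine Submodule.topologicalClosure_minimal _ ?_ hU.isClosed_generatorGraph
    rintro _ ⟨φ, rfl⟩
    exact hC.mem_graph φ
  · rintro ⟨f, g⟩ hfg
    refine Metric.mem_closure_iff.2 fun ε hε => ?_
    -- Approximating `f - g` by `(1 - L) φ` suffices: the lower bound for `1 - L` controls `f - φ`,
    -- and then `g - L φ` costs a second `ε / 2`.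
    obtain ⟨φ, hφ⟩ := (hC.dense_range_sub hU).exists_dist_lt (f - g) (half_pos hε)
    refine ⟨_, ⟨φ, rfl⟩, ?_⟩
    have h1 : (f - ι φ, g - ι (L φ)) ∈ generatorGraph U := sub_mem hfg (hC.mem_graph φ)
    have h2 := hU.norm_le_norm_sub h1
    rw [dist_eq_norm] at hφ
    have h3 : f - g - (ι - ι ∘ₗ L) φ = (f - ι φ) - (g - ι (L φ)) := by
      simp only [LinearMap.sub_apply, LinearMap.comp_apply]; abel
    rw [h3] at hφ
    have h4 : ‖g - ι (L φ)‖ ≤ ‖f - ι φ‖ + ‖(f - ι φ) - (g - ι (L φ))‖ := by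
      simpa using norm_sub_le (f - ι φ) ((f - ι φ) - (g - ι (L φ)))
    rw [Prod.dist_eq, max_lt_iff, dist_eq_norm, dist_eq_norm]
    constructor
    · exact (h2.trans_lt hφ).trans (by linarith)
    · change ‖g - ι (L φ)‖ < ε
      linarith

end HasInvariantCore

end UnitaryGroups

/-! ### Linear isometric flows acting on Schwartz functions and on `L²` -/

section Flows

variable {E : Type*} [NormedAddCommGroup E] [InnerProductSpace ℝ E]

/-- The derivative of a Schwartz function along the linear vector field `D`. -/
def linearFieldDeriv (D : E →L[ℝ] E) : 𝓢(E, ℂ) →ₗ[ℂ] 𝓢(E, ℂ) where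
  toFun φ := bilinLeftCLM (ContinuousLinearMap.apply ℝ ℂ (E := E)).flip
    (ContinuousLinearMap.hasTemperateGrowth D) (fderivCLM ℂ E ℂ φ)
  map_add' φ ψ := by simp
  map_smul' c φ := by
    ext X
    simp [bilinLeftCLM_apply, fderivCLM_apply]

theorem linearFieldDeriv_apply (D : E →L[ℝ] E) (φ : 𝓢(E, ℂ)) (X : E) :
    linearFieldDeriv D φ X = fderiv ℝ φ X (D X) := rfl

/-- The second derivatives cancel by symmetry. The order is reversed because the outer derivation
differentiates the inner field, giving `B (A X)`. -/
theorem linearFieldDeriv_commutator (A B : E →L[ℝ] E) (φ : 𝓢(E, ℂ)) :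
    linearFieldDeriv A (linearFieldDeriv B φ) - linearFieldDeriv B (linearFieldDeriv A φ) =
      linearFieldDeriv (B ∘L A - A ∘L B) φ := by
  have key : ∀ (A B : E →L[ℝ] E) (X : E), linearFieldDeriv A (linearFieldDeriv B φ) X =
      fderiv ℝ (fderiv ℝ φ) X (A X) (B X) + fderiv ℝ φ X (B (A X)) := by
    intro A B X
    rw [linearFieldDeriv_apply]
    have h1 : HasFDerivAt (fderiv ℝ φ) (fderiv ℝ (fderiv ℝ φ) X) X :=
      (((φ.smooth 2).fderiv_right (m := 1) (by norm_num)).differentiable (by norm_num) X).hasFDerivAt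
    have h2 : HasFDerivAt (linearFieldDeriv B φ) _ X := h1.clm_apply B.hasFDerivAt
    rw [h2.fderiv]
    simp [add_comm]
  ext X
  have hs : IsSymmSndFDerivAt ℝ φ X := (φ.smooth 2).contDiffAt.isSymmSndFDerivAt (by simp)
  simp only [_root_.sub_apply, key, linearFieldDeriv_apply, hs.eq (B X) (A X),
    ContinuousLinearMap.comp_apply, map_sub]
  ring

theorem linearFieldDeriv_sum {κ : Type*} (s : Finset κ) (c : κ → ℝ) (A : κ → E →L[ℝ] E)
    (φ : 𝓢(E, ℂ)) :
    linearFieldDeriv (∑ k ∈ s, c k • A k) φ = ∑ k ∈ s, (c k : ℂ) • linearFieldDeriv (A k) φ := by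
  ext X
  simp [linearFieldDeriv_apply]

/-- A one-parameter group of linear isometries, with the generator `D`. -/
structure IsIsometricFlow (D : E →L[ℝ] E) (V : ℝ → E ≃ₗᵢ[ℝ] E) : Prop where
  map_zero : ∀ X, V 0 X = X
  map_add : ∀ s t X, V (s + t) X = V s (V t X)
  continuous : Continuous fun p : ℝ × E => V p.1 p.2
  hasDerivAt : ∀ X t, HasDerivAt (fun t => V t X) (D (V t X)) t

variable {D : E →L[ℝ] E} {V : ℝ → E ≃ₗᵢ[ℝ] E}

theorem IsIsometricFlow.hasDerivAt_comp (hV : IsIsometricFlow D V) (φ : 𝓢(E, ℂ)) (X : E) (t : ℝ) :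
    HasDerivAt (fun t => φ (V t X)) (linearFieldDeriv D φ (V t X)) t :=
  (φ.hasFDerivAt (V t X)).comp_hasDerivAt t (hV.hasDerivAt X t)

/-- A second-order Taylor estimate along the orbit, by two uses of the mean value inequality. An
isometric flow preserves the norm, so a radial bound `w` is constant along each orbit. -/
theorem IsIsometricFlow.norm_sub_sub_le (hV : IsIsometricFlow D V) (φ : 𝓢(E, ℂ)) {w : ℝ → ℝ}
    (hw : ∀ X, ‖linearFieldDeriv D (linearFieldDeriv D φ) X‖ ≤ w ‖X‖) (X : E) (t : ℝ) :
    ‖φ (V t X) - φ X - t * linearFieldDeriv D φ X‖ ≤ t ^ 2 * w ‖X‖ := by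
  set ψ := linearFieldDeriv D φ
  have h0 : 0 ≤ w ‖X‖ := (norm_nonneg _).trans (hw X)
  have h1 : ∀ s, ‖ψ (V s X) - ψ X‖ ≤ w ‖X‖ * |s| := by
    intro s
    have := convex_univ.norm_image_sub_le_of_norm_hasDerivWithin_le (C := w ‖X‖) (x := 0) (y := s)
      (fun s _ => (hV.hasDerivAt_comp ψ X s).hasDerivWithinAt)
      (fun s _ => (hw _).trans (by rw [LinearIsometryEquiv.norm_map])) trivial trivial
    simpa [hV.map_zero] using this
  have h2 : ∀ s, HasDerivAt (fun t : ℝ => φ (V t X) - t * ψ X) (ψ (V s X) - ψ X) s := by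
    intro s
    have h3 : HasDerivAt (fun t : ℝ => (t : ℂ) * ψ X) (ψ X) s := by
      simpa using ((hasDerivAt_id (s : ℂ)).comp_ofReal).mul_const (ψ X)
    exact (hV.hasDerivAt_comp φ X s).sub h3
  have h4 := (convex_closedBall (0 : ℝ) |t|).norm_image_sub_le_of_norm_hasDerivWithin_le
    (C := w ‖X‖ * |t|) (x := 0) (y := t)
    (fun s _ => (h2 s).hasDerivWithinAt)
    (fun s hs => (h1 s).trans (by
      rw [mem_closedBall_zero_iff, Real.norm_eq_abs] at hs
      gcongr)) (by simp) (by simp)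
  have h5 : w ‖X‖ * |t| * ‖t - 0‖ = t ^ 2 * w ‖X‖ := by
    rw [sub_zero, Real.norm_eq_abs, mul_assoc, abs_mul_abs_self]; ring
  rw [h5] at h4
  simp only [hV.map_zero, Complex.ofReal_zero, zero_mul, sub_zero] at h4
  rwa [sub_right_comm] at h4

variable [FiniteDimensional ℝ E] [MeasurableSpace E] [BorelSpace E]

/-- The composition with a linear isometry, as a unitary operator of `L²`. -/
def compUnitary (e : E ≃ₗᵢ[ℝ] E) : unitary (Lp ℂ 2 (volume : Measure E) →L[ℂ] Lp ℂ 2 (volume : Measure E)) :=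
  Unitary.linearIsometryEquiv.symm
    (LinearIsometryEquiv.ofSurjective (Lp.compMeasurePreservingₗᵢ ℂ e e.measurePreserving)
      fun f => ⟨Lp.compMeasurePreserving e.symm e.symm.measurePreserving f, by
        change Lp.compMeasurePreserving _ _ (Lp.compMeasurePreserving _ _ f) = f
        rw [← Lp.compMeasurePreserving_comp_apply]
        convert! Lp.compMeasurePreserving_id_apply f
        ext; simp⟩)

theorem compUnitary_apply (e : E ≃ₗᵢ[ℝ] E) (f : Lp ℂ 2 (volume : Measure E)) :
    (compUnitary e : Lp ℂ 2 (volume : Measure E) →L[ℂ] Lp ℂ 2 (volume : Measure E)) f =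
      Lp.compMeasurePreserving e e.measurePreserving f := rfl

theorem compUnitary_apply_eq_iff (e : E ≃ₗᵢ[ℝ] E) (f : Lp ℂ 2 (volume : Measure E)) :
    (compUnitary e : Lp ℂ 2 (volume : Measure E) →L[ℂ] Lp ℂ 2 (volume : Measure E)) f = f ↔
      ∀ᵐ X, f X = f (e X) := by
  rw [compUnitary_apply, Lp.ext_iff]
  have h := Lp.coeFn_compMeasurePreserving f e.measurePreserving
  constructor
  · intro h1
    filter_upwards [h, h1] with X h2 h3
    rw [← h3, h2]; rfl
  · intro h1
    filter_upwards [h, h1] with X h2 h3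
    rw [h2, h3]; rfl

theorem compUnitary_toLp (e : E ≃ₗᵢ[ℝ] E) (φ : 𝓢(E, ℂ)) :
    (compUnitary e : Lp ℂ 2 (volume : Measure E) →L[ℂ] Lp ℂ 2 (volume : Measure E)) (φ.toLp 2) =
      (compCLMOfContinuousLinearEquiv ℂ e.toContinuousLinearEquiv φ).toLp 2 := by
  rw [compUnitary_apply, SchwartzMap.toLp, Lp.toLp_compMeasurePreserving]
  rfl

/-- A Schwartz function is bounded by a square-integrable function of the norm. -/
theorem exists_memLp_radial_bound (φ : 𝓢(E, ℂ)) :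
    ∃ w : ℝ → ℝ, MemLp (fun X : E => w ‖X‖) 2 ∧ ∀ X, ‖φ X‖ ≤ w ‖X‖ := by
  -- With this decay the square `(1 + ‖X‖)^(-2k)` is integrable, since `2k` exceeds the dimension.
  set k : ℕ := Module.finrank ℝ E + 1 with hk
  obtain ⟨C, hC⟩ : ∃ C, ∀ X, (1 + ‖X‖) ^ k * ‖φ X‖ ≤ C :=
    ⟨_, fun X => by
      simpa using SchwartzMap.one_add_le_sup_seminorm_apply (𝕜 := ℝ) (m := (k, 0)) le_rfl le_rfl φ X⟩
  refine ⟨fun r => C * (1 + r) ^ (-(k : ℝ)), ?_, fun X => ?_⟩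
  · refine MemLp.const_mul ?_ C
    have hc : Continuous fun X : E => (1 + ‖X‖) ^ (-(k : ℝ)) :=
      (continuous_const.add continuous_norm).rpow_const
        fun X => Or.inl (by positivity : 1 + ‖X‖ ≠ 0)
    rw [memLp_two_iff_integrable_sq hc.aestronglyMeasurable]
    have h1 : ∀ X : E, ((1 + ‖X‖) ^ (-(k : ℝ))) ^ 2 = (1 + ‖X‖) ^ (-(2 * k : ℝ)) := by
      intro X
      rw [← Real.rpow_natCast, ← Real.rpow_mul (by positivity)]
      congr 1; push_cast; ring
    simp only [h1]
    refine integrable_one_add_norm ?_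
    rw [hk]; push_cast
    linarith [(Nat.cast_nonneg (Module.finrank ℝ E) : (0 : ℝ) ≤ _)]
  · have hp : 0 < (1 + ‖X‖) ^ k := by positivity
    change _ ≤ C * (1 + ‖X‖) ^ (-(k : ℝ))
    rw [Real.rpow_neg (by positivity), Real.rpow_natCast, ← div_eq_mul_inv, le_div_iff₀ hp, mul_comm]
    exact hC X

/-- The unitary group of the compositions with the elements of a flow. -/
theorem IsIsometricFlow.isUnitaryGroup (hV : IsIsometricFlow D V) :
    IsUnitaryGroup fun t => compUnitary (V t) where
  map_zero := by
    refine Subtype.ext (ContinuousLinearMap.ext fun f => ?_)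
    change _ = f
    rw [compUnitary_apply_eq_iff]
    simp [hV.map_zero]
  map_add s t := by
    refine Subtype.ext (ContinuousLinearMap.ext fun f => ?_)
    change Lp.compMeasurePreserving _ _ f =
      Lp.compMeasurePreserving _ _ (Lp.compMeasurePreserving _ _ f)
    rw [← Lp.compMeasurePreserving_comp_apply]
    have h : ⇑(V (s + t)) = V t ∘ V s := by
      ext X
      rw [add_comm, hV.map_add]; rfl
    simp only [h]
  continuous f := by
    let g : ℝ → C(E, E) := fun t => ⟨V t, (V t).continuous⟩
    have hg : Continuous g := ContinuousMap.continuous_of_continuous_uncurry _ hV.continuous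
    exact (continuous_const (y := f)).compMeasurePreservingLp hg
      (fun t => (V t).measurePreserving) (by norm_num)

/-- The pointwise Taylor remainder is at most `t²` times a fixed square-integrable function, so the
`L²` remainder is `O(t²)`. -/
theorem IsIsometricFlow.mem_generatorGraph (hV : IsIsometricFlow D V) (φ : 𝓢(E, ℂ)) :
    (φ.toLp 2 volume, (linearFieldDeriv D φ).toLp 2 volume) ∈
      generatorGraph fun t => compUnitary (V t) := by
  obtain ⟨w, hw, hb⟩ := exists_memLp_radial_bound (linearFieldDeriv D (linearFieldDeriv D φ))
  refine hV.isUnitaryGroup.mem_generatorGraph_of_norm_le (C := ‖hw.toLp‖) fun t => ?_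
  refine Lp.norm_le_mul_norm_of_ae_le_mul ?_
  rw [compUnitary_toLp]
  filter_upwards [hw.coeFn_toLp,
    Lp.coeFn_sub ((compCLMOfContinuousLinearEquiv ℂ (V t).toContinuousLinearEquiv φ).toLp 2 volume -
      φ.toLp 2 volume) ((t : ℂ) • (linearFieldDeriv D φ).toLp 2 (volume : Measure E)),
    Lp.coeFn_sub ((compCLMOfContinuousLinearEquiv ℂ (V t).toContinuousLinearEquiv φ).toLp 2 volume)
      (φ.toLp 2 (volume : Measure E)),
    Lp.coeFn_smul (t : ℂ) ((linearFieldDeriv D φ).toLp 2 (volume : Measure E)),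
    (compCLMOfContinuousLinearEquiv ℂ (V t).toContinuousLinearEquiv φ).coeFn_toLp 2
      (volume : Measure E), φ.coeFn_toLp 2 (volume : Measure E),
    (linearFieldDeriv D φ).coeFn_toLp 2 (volume : Measure E)] with X h1 h2 h3 h4 h5 h6 h7
  rw [h1, h2, Pi.sub_apply, h3, Pi.sub_apply, h4, Pi.smul_apply, h5, h6, h7]
  have h8 := hV.norm_sub_sub_le φ hb X t
  refine (le_of_eq ?_).trans (h8.trans ?_)
  · simp
  · gcongr
    exact le_abs_self _

theorem IsIsometricFlow.hasInvariantCore (hV : IsIsometricFlow D V) :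
    HasInvariantCore (fun t => compUnitary (V t))
      (toLpCLM ℂ ℂ 2 (volume : Measure E)).toLinearMap
      (fun t φ => compCLMOfContinuousLinearEquiv ℂ (V t).toContinuousLinearEquiv φ)
      (linearFieldDeriv D) where
  denseRange := SchwartzMap.denseRange_toLpCLM (by norm_num)
  intertwine t φ := compUnitary_toLp (V t) φ
  mem_graph φ := hV.mem_generatorGraph φ

end Flows

/-! ### Rotations by right multiplication with `e^{tA}` -/

section MatrixFlows

variable {m n : ℕ}

namespace MatSpace

theorem mulRight_apply (X : MatSpace m n) (B : Matrix (Fin n) (Fin n) ℝ) (i : Fin m) (j : Fin n) :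
    X.mulRight B (i, j) = ∑ k, X (i, k) * B k j := by
  simp [mulRight, toMatrix, Matrix.mul_apply]

theorem toMatrix_mulRight (X : MatSpace m n) (B : Matrix (Fin n) (Fin n) ℝ) :
    (X.mulRight B).toMatrix = X.toMatrix * B := rfl

theorem mulRight_mul (X : MatSpace m n) (A B : Matrix (Fin n) (Fin n) ℝ) :
    X.mulRight (A * B) = (X.mulRight A).mulRight B := by
  ext ⟨i, j⟩
  change (X.toMatrix * (A * B)) i j = (X.toMatrix * A * B) i j
  rw [Matrix.mul_assoc]

theorem mulRight_one (X : MatSpace m n) : X.mulRight 1 = X := by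
  simp [mulRight, toMatrix]

theorem norm_sq_eq_trace (X : MatSpace m n) : ‖X‖ ^ 2 = (X.toMatrix * X.toMatrixᵀ).trace := by
  rw [EuclideanSpace.norm_sq_eq, Fintype.sum_prod_type]
  simp [Matrix.trace, Matrix.mul_apply, toMatrix, pow_two]

theorem norm_mulRight {B : Matrix (Fin n) (Fin n) ℝ} (hB : B * Bᵀ = 1) (X : MatSpace m n) :
    ‖X.mulRight B‖ = ‖X‖ := by
  refine (sq_eq_sq₀ (norm_nonneg _) (norm_nonneg _)).1 ?_
  rw [norm_sq_eq_trace, norm_sq_eq_trace, toMatrix_mulRight, Matrix.transpose_mul, Matrix.mul_assoc,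
    ← Matrix.mul_assoc B, hB, Matrix.one_mul]

/-- The right multiplication by a matrix, as a continuous linear map. -/
def mulRightCLM (m : ℕ) {n : ℕ} (B : Matrix (Fin n) (Fin n) ℝ) : MatSpace m n →L[ℝ] MatSpace m n :=
  LinearMap.toContinuousLinearMap
    { toFun := fun X => X.mulRight B
      map_add' := fun X Y => by
        ext ⟨i, j⟩; simp [mulRight_apply, add_mul, Finset.sum_add_distrib]
      map_smul' := fun c X => by
        ext ⟨i, j⟩; simp [mulRight_apply, mul_assoc, Finset.mul_sum] }

@[simp]
theorem mulRightCLM_apply (B : Matrix (Fin n) (Fin n) ℝ) (X : MatSpace m n) :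
    mulRightCLM m B X = X.mulRight B := rfl

/-- Right multiplication reverses products, which undoes the reversal in
`linearFieldDeriv_commutator`. -/
theorem mulRightCLM_comp (A B : Matrix (Fin n) (Fin n) ℝ) :
    mulRightCLM m A ∘L mulRightCLM m B = mulRightCLM m (B * A) := by
  ext1 X
  exact (mulRight_mul X B A).symm

theorem mulRightCLM_sub (A B : Matrix (Fin n) (Fin n) ℝ) :
    mulRightCLM m (A - B) = mulRightCLM m A - mulRightCLM m B := by
  ext X ⟨i, j⟩
  simp [mulRight_apply, mul_sub]

theorem mulRightCLM_sum {κ : Type*} (s : Finset κ) (c : κ → ℝ)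
    (A : κ → Matrix (Fin n) (Fin n) ℝ) :
    mulRightCLM m (∑ k ∈ s, c k • A k) = ∑ k ∈ s, c k • mulRightCLM m (A k) := by
  ext X ⟨i, j⟩
  simp only [mulRightCLM_apply, mulRight_apply, Matrix.sum_apply, Matrix.smul_apply, smul_eq_mul,
    Finset.mul_sum, _root_.sum_apply, _root_.smul_apply, WithLp.ofLp_sum, Finset.sum_apply,
    WithLp.ofLp_smul, Pi.smul_apply]
  rw [Finset.sum_comm]
  exact Finset.sum_congr rfl fun _ _ => Finset.sum_congr rfl fun _ _ => by ring

end MatSpace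

theorem Matrix.hasDerivAt_exp_smul_apply (A : Matrix (Fin n) (Fin n) ℝ) (t : ℝ) (i j : Fin n) :
    HasDerivAt (fun t : ℝ => NormedSpace.exp (t • A) i j) ((NormedSpace.exp (t • A) * A) i j) t := by
  -- An auxiliary algebra norm; the choice is immaterial, as the claim concerns entries only.
  let : NormedRing (Matrix (Fin n) (Fin n) ℝ) := Matrix.linftyOpNormedRing
  let : NormedAlgebra ℝ (Matrix (Fin n) (Fin n) ℝ) := Matrix.linftyOpNormedAlgebra
  have h := hasDerivAt_exp_smul_const (𝕂 := ℝ) A t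
  have h1 := (LinearMap.toContinuousLinearMap (Matrix.entryLinearMap ℝ ℝ i j)).hasFDerivAt.comp_hasDerivAt t h
  exact h1

theorem Matrix.exp_mul_exp_neg (A : Matrix (Fin n) (Fin n) ℝ) :
    NormedSpace.exp A * NormedSpace.exp (-A) = 1 := by
  rw [← Matrix.exp_add_of_commute _ _ (Commute.refl A).neg_right, add_neg_cancel,
    NormedSpace.exp_zero]

theorem Matrix.exp_mul_transpose_exp {A : Matrix (Fin n) (Fin n) ℝ} (hA : Aᵀ = -A) :
    NormedSpace.exp A * (NormedSpace.exp A)ᵀ = 1 := by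
  rw [← Matrix.exp_transpose, hA, Matrix.exp_mul_exp_neg]

/-- The rotation `X ↦ X e^A` for an antisymmetric matrix `A`. -/
def matRotation (m : ℕ) {n : ℕ} (A : Matrix (Fin n) (Fin n) ℝ) (hA : Aᵀ = -A) :
    MatSpace m n ≃ₗᵢ[ℝ] MatSpace m n where
  toFun X := X.mulRight (NormedSpace.exp A)
  invFun X := X.mulRight (NormedSpace.exp (-A))
  left_inv X := by
    beta_reduce
    rw [← MatSpace.mulRight_mul, Matrix.exp_mul_exp_neg, MatSpace.mulRight_one]
  right_inv X := by
    have h := Matrix.exp_mul_exp_neg (-A)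
    rw [neg_neg] at h
    beta_reduce
    rw [← MatSpace.mulRight_mul, h, MatSpace.mulRight_one]
  map_add' X Y := map_add (MatSpace.mulRightCLM m (NormedSpace.exp A)) X Y
  map_smul' c X := map_smul (MatSpace.mulRightCLM m (NormedSpace.exp A)) c X
  norm_map' X := MatSpace.norm_mulRight (Matrix.exp_mul_transpose_exp hA) X

@[simp]
theorem matRotation_apply (A : Matrix (Fin n) (Fin n) ℝ) (hA : Aᵀ = -A) (X : MatSpace m n) :
    matRotation m A hA X = X.mulRight (NormedSpace.exp A) := rfl

theorem Matrix.transpose_smul_eq_neg {A : Matrix (Fin n) (Fin n) ℝ} (hA : Aᵀ = -A) (t : ℝ) :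
    (t • A)ᵀ = -(t • A) := by
  rw [Matrix.transpose_smul, hA, smul_neg]

theorem isIsometricFlow_matRotation {A : Matrix (Fin n) (Fin n) ℝ} (hA : Aᵀ = -A) :
    IsIsometricFlow (MatSpace.mulRightCLM m A)
      fun t => matRotation m (t • A) (Matrix.transpose_smul_eq_neg hA t) where
  map_zero X := by
    simp [MatSpace.mulRight_one]
  map_add s t X := by
    rw [matRotation_apply, matRotation_apply, matRotation_apply, ← MatSpace.mulRight_mul, add_comm, add_smul,
      Matrix.exp_add_of_commute _ _ (((Commute.refl A).smul_left t).smul_right s)]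
  continuous := by
    have h : ∀ i j, Continuous fun t : ℝ => NormedSpace.exp (t • A) i j := fun i j =>
      continuous_iff_continuousAt.2 fun t => (Matrix.hasDerivAt_exp_smul_apply A t i j).continuousAt
    refine (PiLp.continuousLinearEquiv 2 ℝ fun _ : Fin m × Fin n => ℝ).symm.continuous.comp
      (g := fun f => WithLp.toLp 2 f) (f := fun q : ℝ × MatSpace m n => fun p =>
        q.2.mulRight (NormedSpace.exp (q.1 • A)) p) ?_
    refine continuous_pi fun p => ?_
    change Continuous fun q : ℝ × MatSpace m n => q.2.mulRight (NormedSpace.exp (q.1 • A)) (p.1, p.2)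
    simp only [MatSpace.mulRight_apply]
    refine continuous_finsetSum _ fun k _ => ?_
    exact Continuous.mul (by fun_prop) ((h k p.2).comp continuous_fst)
  hasDerivAt X t := by
    have h : HasDerivAt (fun t => fun p : Fin m × Fin n => X.mulRight (NormedSpace.exp (t • A)) p)
        (fun p => (X.mulRight (NormedSpace.exp (t • A))).mulRight A p) t := by
      refine hasDerivAt_pi.2 fun p => ?_
      rw [← MatSpace.mulRight_mul]
      obtain ⟨i, j⟩ := p
      simp only [MatSpace.mulRight_apply]
      exact HasDerivAt.fun_sum fun k _ =>
        (Matrix.hasDerivAt_exp_smul_apply A t k j).const_mul (X (i, k))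
    exact ((PiLp.continuousLinearEquiv 2 ℝ fun _ : Fin m × Fin n => ℝ).symm :
      (Fin m × Fin n → ℝ) →L[ℝ] MatSpace m n).hasFDerivAt.comp_hasDerivAt t h

end MatrixFlows

/-! ### Graphs of sums, compositions and closures of unbounded operators -/

section PartialMaps

variable {H : Type*} [NormedAddCommGroup H] [InnerProductSpace ℂ H]

theorem LinearPMap.mem_domain_sum {κ : Type*} (s : Finset κ) (T : κ → H →ₗ.[ℂ] H) (f : H) :
    f ∈ (∑ k ∈ s, T k).domain ↔ ∀ k ∈ s, f ∈ (T k).domain := by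
  classical
  induction s using Finset.induction_on with
  | empty => simp
  | insert a s ha ih =>
    rw [Finset.sum_insert ha, LinearPMap.add_domain, Submodule.mem_inf, ih]
    simp

theorem LinearPMap.mem_graph_add {S T : H →ₗ.[ℂ] H} {f g h : H} (hS : (f, g) ∈ S.graph)
    (hT : (f, h) ∈ T.graph) : (f, g + h) ∈ (S + T).graph := by
  obtain ⟨y, hy, rfl⟩ := (LinearPMap.mem_graph_iff _).1 hS
  obtain ⟨z, hz, rfl⟩ := (LinearPMap.mem_graph_iff _).1 hT
  subst hy
  have hd : (y : H) ∈ T.domain := by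
    have h := z.2
    rwa [show (z : H) = y from hz] at h
  have hzy : z = ⟨y, hd⟩ := Subtype.ext hz
  refine (LinearPMap.mem_graph_iff _).2 ⟨⟨y, y.2, hd⟩, rfl, ?_⟩
  rw [LinearPMap.add_apply, hzy]

theorem LinearPMap.mem_graph_sub {S T : H →ₗ.[ℂ] H} {f g h : H} (hS : (f, g) ∈ S.graph)
    (hT : (f, h) ∈ T.graph) : (f, g - h) ∈ (S - T).graph := by
  obtain ⟨y, hy, rfl⟩ := (LinearPMap.mem_graph_iff _).1 hS
  obtain ⟨z, hz, rfl⟩ := (LinearPMap.mem_graph_iff _).1 hT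
  subst hy
  have hd : (y : H) ∈ T.domain := by
    have h := z.2
    rwa [show (z : H) = y from hz] at h
  have hzy : z = ⟨y, hd⟩ := Subtype.ext hz
  refine (LinearPMap.mem_graph_iff _).2 ⟨⟨y, y.2, hd⟩, rfl, ?_⟩
  rw [LinearPMap.sub_apply, hzy]

theorem LinearPMap.mem_graph_sum {κ : Type*} (s : Finset κ) {T : κ → H →ₗ.[ℂ] H} {f : H} {g : κ → H}
    (h : ∀ k ∈ s, (f, g k) ∈ (T k).graph) : (f, ∑ k ∈ s, g k) ∈ (∑ k ∈ s, T k).graph := by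
  classical
  induction s using Finset.induction_on with
  | empty => simp [LinearPMap.mem_graph_iff]
  | insert a s ha ih =>
    rw [Finset.sum_insert ha, Finset.sum_insert ha]
    exact LinearPMap.mem_graph_add (h a (by simp)) (ih fun k hk => h k (by simp [hk]))

theorem mem_graph_opComp {S T : H →ₗ.[ℂ] H} {f g h : H} (hT : (f, g) ∈ T.graph)
    (hS : (g, h) ∈ S.graph) : (f, h) ∈ (opComp S T).graph := by
  obtain ⟨y, hy, rfl⟩ := (LinearPMap.mem_graph_iff _).1 hT
  obtain ⟨z, hz, rfl⟩ := (LinearPMap.mem_graph_iff _).1 hS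
  dsimp only at hy hz
  subst hy
  have hd : T y ∈ S.domain := hz ▸ z.2
  refine (LinearPMap.mem_graph_iff _).2 ⟨⟨y, (mem_opComp_domain S T y).2 ⟨y.2, hd⟩⟩, rfl, ?_⟩
  rw [opComp_apply S T y _ y.2 hd]
  exact congrArg S (Subtype.ext hz.symm)

/-- An operator whose graph has the closure `G`, which is the graph of a function, is closable. -/
theorem LinearPMap.graph_closure_of_topologicalClosure_eq {T : H →ₗ.[ℂ] H} {G : Submodule ℂ (H × H)}
    (h : T.graph.topologicalClosure = G) (hG : ∀ x ∈ G, x.1 = 0 → x.2 = 0) :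
    T.closure.graph = G := by
  have hc : T.IsClosable := ⟨G.toLinearPMap, by rw [Submodule.toLinearPMap_graph_eq G hG, h]⟩
  rw [← hc.graph_closure_eq_closure_graph, h]

end PartialMaps

/-! ### Identification of `v_{j,k}` with the generator of a rotation group -/

section CreationOperators

variable {m n : ℕ}

theorem coordinate_hasTemperateGrowth (p : Fin m × Fin n) :
    (fun X : MatSpace m n => ((X p : ℝ) : ℂ)).HasTemperateGrowth := by
  have : (fun X : MatSpace m n => ((X p : ℝ) : ℂ)) =
      (Complex.ofRealCLM ∘L (EuclideanSpace.proj p : MatSpace m n →L[ℝ] ℝ)) := by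
    ext X; simp
  rw [this]
  exact ContinuousLinearMap.hasTemperateGrowth _

theorem annihilationSchwartz_apply_eq_fderiv (i : Fin m) (j : Fin n) (φ : 𝓢(MatSpace m n, ℂ))
    (X : MatSpace m n) :
    annihilationSchwartz i j φ X =
      (X (i, j) * φ X + fderiv ℝ φ X (EuclideanSpace.single (i, j) 1)) / Real.sqrt 2 := by
  rw [annihilationSchwartz_apply, (φ.hasFDerivAt X).differentiableAt.lineDeriv_eq_fderiv]

/-- The operator `f ↦ (x_{i,j} f - ∂f/∂x_{i,j}) / √2` on Schwartz functions. -/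
def creationSchwartz (i : Fin m) (j : Fin n) : 𝓢(MatSpace m n, ℂ) →ₗ[ℂ] 𝓢(MatSpace m n, ℂ) :=
  ((Real.sqrt 2 : ℝ) : ℂ)⁻¹ •
    ((smulLeftCLM ℂ (fun X : MatSpace m n => ((X (i, j) : ℝ) : ℂ))).toLinearMap -
      (LineDeriv.lineDerivOpCLM ℂ 𝓢(MatSpace m n, ℂ)
        (EuclideanSpace.single (i, j) (1 : ℝ))).toLinearMap)

theorem creationSchwartz_apply (i : Fin m) (j : Fin n) (φ : 𝓢(MatSpace m n, ℂ))
    (X : MatSpace m n) :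
    creationSchwartz i j φ X =
      (X (i, j) * φ X - fderiv ℝ φ X (EuclideanSpace.single (i, j) 1)) / Real.sqrt 2 := by
  simp only [creationSchwartz, LinearMap.smul_apply, LinearMap.sub_apply,
    ContinuousLinearMap.coe_coe, _root_.smul_apply, _root_.sub_apply,
    smulLeftCLM_apply_apply (coordinate_hasTemperateGrowth (i, j)), smul_eq_mul,
    LineDeriv.lineDerivOpCLM_apply, SchwartzMap.lineDerivOp_apply_eq_fderiv]
  rw [div_eq_inv_mul]

/-- Integration by parts moves the derivative with a change of sign; multiplication by the real
coordinate is symmetric. -/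
theorem inner_annihilationSchwartz (i : Fin m) (j : Fin n) (φ ψ : 𝓢(MatSpace m n, ℂ)) :
    inner ℂ (schwartzToL2 m n (creationSchwartz i j ψ)) (schwartzToL2 m n φ) =
      inner ℂ (schwartzToL2 m n ψ) (schwartzToL2 m n (annihilationSchwartz i j φ)) := by
  set e : MatSpace m n := EuclideanSpace.single (i, j) 1
  set B : ℂ →L[ℝ] ℂ →L[ℝ] ℂ :=
    (ContinuousLinearMap.mul ℝ ℂ).comp (Complex.conjCLE : ℂ →L[ℝ] ℂ) with hB
  have hBa : ∀ a b, B a b = starRingEnd ℂ a * b := fun a b => by simp [hB]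
  have h := integral_bilinear_lineDerivOp_right_eq_neg_left (μ := volume) ψ φ B e
  have hi : ∀ f g : 𝓢(MatSpace m n, ℂ), Integrable fun X => starRingEnd ℂ (f X) * g X := fun f g => by
    have := (bilinLeftCLM B g.hasTemperateGrowth f).integrable (μ := volume)
    simpa only [bilinLeftCLM_apply, hBa] using this
  simp only [hBa] at h
  have h1 : inner ℂ (schwartzToL2 m n (creationSchwartz i j ψ)) (schwartzToL2 m n φ) =
      ∫ X, starRingEnd ℂ (creationSchwartz i j ψ X) * φ X := by
    refine (inner_toL2_toL2_eq _ _ volume).trans (integral_congr_ae (.of_forall fun X => ?_))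
    simp [mul_comm]
  have h2 : inner ℂ (schwartzToL2 m n ψ) (schwartzToL2 m n (annihilationSchwartz i j φ)) =
      ∫ X, starRingEnd ℂ (ψ X) * annihilationSchwartz i j φ X := by
    refine (inner_toL2_toL2_eq _ _ volume).trans (integral_congr_ae (.of_forall fun X => ?_))
    simp [mul_comm]
  rw [h1, h2, ← sub_eq_zero, ← integral_sub (hi _ _) (hi _ _)]
  have h3 : ∀ X, starRingEnd ℂ (creationSchwartz i j ψ X) * φ X -
      starRingEnd ℂ (ψ X) * annihilationSchwartz i j φ X =
      -((Real.sqrt 2 : ℂ)⁻¹ * (starRingEnd ℂ ((∂_{e} ψ : 𝓢(MatSpace m n, ℂ)) X) * φ X +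
        starRingEnd ℂ (ψ X) * (∂_{e} φ : 𝓢(MatSpace m n, ℂ)) X)) := by
    intro X
    rw [creationSchwartz_apply, annihilationSchwartz_apply_eq_fderiv,
      SchwartzMap.lineDerivOp_apply_eq_fderiv, SchwartzMap.lineDerivOp_apply_eq_fderiv]
    simp only [map_div₀, map_sub, map_mul, Complex.conj_ofReal]
    ring
  simp only [h3]
  rw [integral_neg, integral_const_mul, integral_add (hi _ _) (hi _ _), h]
  simp

theorem dense_annihilation_domain (i : Fin m) (j : Fin n) :
    Dense ((annihilation i j).domain : Set (HilbertMN m n)) :=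
  SchwartzMap.denseRange_toLpCLM (μ := (volume : Measure (MatSpace m n))) (p := 2) (by norm_num)

theorem mem_graph_annihilation (i : Fin m) (j : Fin n) (φ : 𝓢(MatSpace m n, ℂ)) :
    (schwartzToL2 m n φ, schwartzToL2 m n (annihilationSchwartz i j φ)) ∈
      (annihilation i j).graph :=
  (LinearPMap.mem_graph_iff _).2 ⟨⟨_, φ, rfl⟩, rfl, annihilation_apply i j φ⟩

theorem mem_graph_adjoint_annihilation (i : Fin m) (j : Fin n) (φ : 𝓢(MatSpace m n, ℂ)) :
    (schwartzToL2 m n φ, schwartzToL2 m n (creationSchwartz i j φ)) ∈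
      (annihilation i j).adjoint.graph := by
  have h : ∀ x : (annihilation i j).domain,
      inner ℂ (schwartzToL2 m n (creationSchwartz i j φ)) (x : HilbertMN m n) =
        inner ℂ (schwartzToL2 m n φ) (annihilation i j x) := by
    rintro ⟨_, ψ, rfl⟩
    rw [annihilation_apply]
    exact inner_annihilationSchwartz i j ψ φ
  have hd := LinearPMap.mem_adjoint_domain_of_exists (T := annihilation i j) _ ⟨_, h⟩
  exact (LinearPMap.mem_graph_iff _).2
    ⟨⟨_, hd⟩, rfl, LinearPMap.adjoint_apply_eq (dense_annihilation_domain i j) ⟨_, hd⟩ h⟩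

theorem creationSchwartz_annihilationSchwartz_apply (i : Fin m) (j k : Fin n)
    (φ : 𝓢(MatSpace m n, ℂ)) (X : MatSpace m n) :
    creationSchwartz i k (annihilationSchwartz i j φ) X =
      (X (i, k) * X (i, j) * φ X + X (i, k) * fderiv ℝ φ X (EuclideanSpace.single (i, j) 1)
        - (if j = k then 1 else 0) * φ X
        - X (i, j) * fderiv ℝ φ X (EuclideanSpace.single (i, k) 1)
        - fderiv ℝ (fderiv ℝ φ) X (EuclideanSpace.single (i, k) 1)
          (EuclideanSpace.single (i, j) 1)) / 2 := by
  have h1 : HasFDerivAt (fderiv ℝ φ) (fderiv ℝ (fderiv ℝ φ) X) X :=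
    (((φ.smooth 2).fderiv_right (m := 1) (by norm_num)).differentiable (by norm_num) X).hasFDerivAt
  have h2 : HasFDerivAt (fun X : MatSpace m n => ((X (i, j) : ℝ) : ℂ))
      (Complex.ofRealCLM ∘L (EuclideanSpace.proj (i, j) : MatSpace m n →L[ℝ] ℝ)) X :=
    (Complex.ofRealCLM ∘L (EuclideanSpace.proj (i, j) : MatSpace m n →L[ℝ] ℝ)).hasFDerivAt
  have h3 := ((h2.mul (φ.hasFDerivAt X)).add
    (h1.clm_apply (hasFDerivAt_const (EuclideanSpace.single (i, j) (1 : ℝ)) X))).mul_const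
    (Real.sqrt 2 : ℂ)⁻¹
  have h4 : HasFDerivAt (annihilationSchwartz i j φ) _ X :=
    h3.congr_of_eventuallyEq (.of_forall fun Y => by
      rw [annihilationSchwartz_apply_eq_fderiv, div_eq_mul_inv]; rfl)
  have hs : (Real.sqrt 2 : ℂ) * (Real.sqrt 2 : ℂ) = 2 := by
    rw [← Complex.ofReal_mul, Real.mul_self_sqrt (by norm_num)]; norm_num
  have hs' : (Real.sqrt 2 : ℂ)⁻¹ * (Real.sqrt 2 : ℂ)⁻¹ = 2⁻¹ := by rw [← mul_inv, hs]
  rw [creationSchwartz_apply, h4.fderiv, annihilationSchwartz_apply_eq_fderiv]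
  by_cases hjk : j = k
  all_goals
    simp [div_eq_mul_inv, hjk]
    rw [← hs']
    ring

/-- The matrix of the rotation that is generated by `v_{j,k}`. -/
def rotationGenerator (j k : Fin n) : Matrix (Fin n) (Fin n) ℝ :=
  Matrix.single k j 1 - Matrix.single j k 1

theorem rotationGenerator_transpose (j k : Fin n) :
    (rotationGenerator j k)ᵀ = -rotationGenerator j k := by
  simp [rotationGenerator]

theorem mulRight_rotationGenerator (X : MatSpace m n) (j k : Fin n) :
    X.mulRight (rotationGenerator j k) =
      ∑ i, (X (i, k) • EuclideanSpace.single (i, j) (1 : ℝ) -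
        X (i, j) • EuclideanSpace.single (i, k) (1 : ℝ)) := by
  ext ⟨a, b⟩
  simp only [MatSpace.mulRight_apply, rotationGenerator, Matrix.sub_apply, Matrix.single_apply,
    WithLp.ofLp_sum, Finset.sum_apply, WithLp.ofLp_sub, WithLp.ofLp_smul, Pi.sub_apply,
    Pi.smul_apply, smul_eq_mul, PiLp.single_apply, Prod.mk.injEq, mul_sub,
    Finset.sum_sub_distrib]
  congr 1
  all_goals simp [ite_and, eq_comm]

/-- Antisymmetrizing in `j, k` removes the quadratic, constant and second-derivative terms. The
mixed terms occur twice, which cancels the factor `1/2`. -/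
theorem sum_creation_annihilation (j k : Fin n) (φ : 𝓢(MatSpace m n, ℂ)) :
    ∑ i, (creationSchwartz i k (annihilationSchwartz i j φ) -
      creationSchwartz i j (annihilationSchwartz i k φ)) =
      linearFieldDeriv (MatSpace.mulRightCLM m (rotationGenerator j k)) φ := by
  ext X
  have hs : IsSymmSndFDerivAt ℝ φ X := (φ.smooth 2).contDiffAt.isSymmSndFDerivAt (by simp)
  rw [linearFieldDeriv_apply, MatSpace.mulRightCLM_apply, mulRight_rotationGenerator, map_sum,
    _root_.sum_apply]
  refine Finset.sum_congr rfl fun i _ => ?_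
  rw [_root_.sub_apply, creationSchwartz_annihilationSchwartz_apply,
    creationSchwartz_annihilationSchwartz_apply, hs.eq, map_sub, map_smul, map_smul]
  simp only [eq_comm (a := k) (b := j), Complex.real_smul]
  ring

/-- The graph of the operator `∑ᵢ (a_{i,k}^* a_{i,j} - a_{i,j}^* a_{i,k})` on Schwartz functions. -/
theorem graph_sum_opComp (hm : 1 ≤ m) (j k : Fin n) :
    (∑ i : Fin m, (opComp (annihilation i k).adjoint (annihilation i j) -
      opComp (annihilation i j).adjoint (annihilation i k))).graph =
    LinearMap.range ((schwartzToL2 m n).prod (schwartzToL2 m n ∘ₗ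
      linearFieldDeriv (MatSpace.mulRightCLM m (rotationGenerator j k)))) := by
  have h1 : ∀ φ : 𝓢(MatSpace m n, ℂ), (schwartzToL2 m n φ, schwartzToL2 m n
      (linearFieldDeriv (MatSpace.mulRightCLM m (rotationGenerator j k)) φ)) ∈
      (∑ i : Fin m, (opComp (annihilation i k).adjoint (annihilation i j) -
        opComp (annihilation i j).adjoint (annihilation i k))).graph := by
    intro φ
    rw [← sum_creation_annihilation, map_sum]
    refine LinearPMap.mem_graph_sum _ fun i _ => ?_
    rw [map_sub]
    exact LinearPMap.mem_graph_sub
      (mem_graph_opComp (mem_graph_annihilation i j φ) (mem_graph_adjoint_annihilation i k _))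
      (mem_graph_opComp (mem_graph_annihilation i k φ) (mem_graph_adjoint_annihilation i j _))
  apply le_antisymm
  · rintro ⟨f, g⟩ hfg
    have hd := LinearPMap.mem_domain_of_mem_graph hfg
    -- One summand already forces `f` to be Schwartz. For `m = 0` the empty sum would be defined
    -- everywhere.
    have hd' := (LinearPMap.mem_domain_sum _ _ _).1 hd ⟨0, hm⟩ (Finset.mem_univ _)
    rw [LinearPMap.sub_domain, Submodule.mem_inf, mem_opComp_domain] at hd'
    obtain ⟨⟨⟨φ, rfl⟩, -⟩, -⟩ := hd'
    exact ⟨φ, Prod.ext rfl (LinearPMap.mem_graph_snd_inj _ (h1 φ) hfg rfl)⟩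
  · rintro _ ⟨φ, rfl⟩
    exact h1 φ

/-- The unitary group `f ↦ f(X e^{tA})`. -/
def rotationGroup (m : ℕ) {n : ℕ} (A : Matrix (Fin n) (Fin n) ℝ) (hA : Aᵀ = -A) (t : ℝ) :
    unitary (HilbertMN m n →L[ℂ] HilbertMN m n) :=
  compUnitary (matRotation m (t • A) (Matrix.transpose_smul_eq_neg hA t))

theorem isUnitaryGroup_rotationGroup {A : Matrix (Fin n) (Fin n) ℝ} (hA : Aᵀ = -A) :
    IsUnitaryGroup (rotationGroup m A hA) :=
  (isIsometricFlow_matRotation hA).isUnitaryGroup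

theorem hasInvariantCore_rotationGroup {A : Matrix (Fin n) (Fin n) ℝ} (hA : Aᵀ = -A) :
    HasInvariantCore (rotationGroup m A hA) (schwartzToL2 m n)
      (fun t φ => compCLMOfContinuousLinearEquiv ℂ
        (matRotation m (t • A) (Matrix.transpose_smul_eq_neg hA t)).toContinuousLinearEquiv φ)
      (linearFieldDeriv (MatSpace.mulRightCLM m A)) :=
  (isIsometricFlow_matRotation hA).hasInvariantCore

/-- Schwartz functions form an invariant core, so the graph closure is the whole generator; a
generator being single-valued, the operator is closable. -/
theorem vOp_graph (hm : 1 ≤ m) (j k : Fin n) :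
    (vOp j k : HilbertMN m n →ₗ.[ℂ] HilbertMN m n).graph =
      generatorGraph (rotationGroup m (rotationGenerator j k) (rotationGenerator_transpose j k)) := by
  refine LinearPMap.graph_closure_of_topologicalClosure_eq ?_ ?_
  · rw [graph_sum_opComp hm]
    exact (hasInvariantCore_rotationGroup _).generatorGraph_eq (isUnitaryGroup_rotationGroup _)
  · rintro ⟨f, g⟩ h rfl
    rw [mem_generatorGraph] at h
    simp only [map_zero] at h
    exact h.unique (hasDerivAt_const _ _)

theorem dense_vOp_domain (hm : 1 ≤ m) (j k : Fin n) :
    Dense ((vOp j k : HilbertMN m n →ₗ.[ℂ] HilbertMN m n).domain : Set (HilbertMN m n)) := by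
  have hC := hasInvariantCore_rotationGroup (m := m) (rotationGenerator_transpose j k)
  refine hC.denseRange.mono ?_
  rintro _ ⟨φ, rfl⟩
  have h := hC.mem_graph φ
  rw [← vOp_graph hm] at h
  exact LinearPMap.mem_domain_of_mem_graph h

end CreationOperators

/-! ### Adjoints and vectors fixed by unitary groups -/

section PartialMaps

variable {H : Type*} [NormedAddCommGroup H] [InnerProductSpace ℂ H]

theorem exists_mem_graph_of_mem_graph_opComp {S T : H →ₗ.[ℂ] H} {f h : H}
    (hf : (f, h) ∈ (opComp S T).graph) : ∃ g, (f, g) ∈ T.graph ∧ (g, h) ∈ S.graph := by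
  obtain ⟨⟨y, hy⟩, hyf, hyh⟩ := (LinearPMap.mem_graph_iff _).1 hf
  dsimp only at hyf hyh
  subst hyf
  obtain ⟨hT, hS⟩ := (mem_opComp_domain S T y).1 hy
  refine ⟨T ⟨y, hT⟩, LinearPMap.mem_graph T ⟨y, hT⟩, ?_⟩
  rw [← hyh, opComp_apply S T y hy hT hS]
  exact LinearPMap.mem_graph S ⟨_, hS⟩

theorem mem_graph_ofBounded {B : H →L[ℂ] H} {f g : H} :
    (f, g) ∈ (ofBounded B).graph ↔ g = B f := by
  constructor
  · intro h
    obtain ⟨y, hy, hg⟩ := (LinearPMap.mem_graph_iff _).1 h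
    dsimp only at hy hg
    rw [← hg, ← hy]; rfl
  · rintro rfl
    exact (LinearPMap.mem_graph_iff _).2 ⟨⟨f, trivial⟩, rfl, rfl⟩

variable [CompleteSpace H]

theorem LinearPMap.inner_eq_of_mem_graph_adjoint {T : H →ₗ.[ℂ] H} (hT : Dense (T.domain : Set H))
    {f f' g g' : H} (h : (f, f') ∈ T.adjoint.graph) (h' : (g, g') ∈ T.graph) :
    inner ℂ f g' = inner ℂ f' g := by
  obtain ⟨y, rfl, rfl⟩ := (LinearPMap.mem_graph_iff _).1 h
  obtain ⟨z, rfl, rfl⟩ := (LinearPMap.mem_graph_iff _).1 h'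
  exact (LinearPMap.adjoint_isFormalAdjoint hT y z).symm

theorem LinearPMap.mem_graph_adjoint_zero {T : H →ₗ.[ℂ] H} (hT : Dense (T.domain : Set H)) {f : H}
    (h : ∀ g g', (g, g') ∈ T.graph → inner ℂ f g' = 0) : (f, 0) ∈ T.adjoint.graph := by
  have h1 : ∀ x : T.domain, inner ℂ (0 : H) (x : H) = inner ℂ f (T x) := fun x => by
    rw [h _ _ (LinearPMap.mem_graph T x), inner_zero_left]
  have hd := LinearPMap.mem_adjoint_domain_of_exists (T := T) _ ⟨_, h1⟩
  exact (LinearPMap.mem_graph_iff _).2 ⟨⟨_, hd⟩, rfl, LinearPMap.adjoint_apply_eq hT ⟨_, hd⟩ h1⟩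

theorem inner_eq_zero_of_invariant {U : ℝ → unitary (H →L[ℂ] H)} {f g g' : H}
    (hf : ∀ t, (U t : H →L[ℂ] H) f = f) (h : (g, g') ∈ generatorGraph U) : inner ℂ f g' = 0 := by
  have h1 : HasDerivAt (fun t : ℝ => (U t : H →L[ℂ] H) g) g' 0 := h
  have h2 := (hasDerivAt_const (0 : ℝ) f).inner ℂ h1
  have h3 : (fun t : ℝ => inner ℂ f ((U t : H →L[ℂ] H) g)) = fun _ => inner ℂ f g := by
    funext t
    have h4 := (Unitary.linearIsometryEquiv (U t)).inner_map_map f g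
    change inner ℂ ((U t : H →L[ℂ] H) f) ((U t : H →L[ℂ] H) g) = _ at h4
    rwa [hf] at h4
  rw [h3] at h2
  simpa using h2.unique (hasDerivAt_const _ _)

theorem unitary_star_apply_apply (u : unitary (H →L[ℂ] H)) (f : H) :
    (star u : H →L[ℂ] H) ((u : H →L[ℂ] H) f) = f := by
  rw [← mul_apply_eq_comp, Unitary.coe_star_mul_self]; rfl

theorem unitary_list_prod_apply_eq {l : List (unitary (H →L[ℂ] H))} {f : H}
    (h : ∀ u ∈ l, (u : H →L[ℂ] H) f = f) : (l.prod : H →L[ℂ] H) f = f := by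
  induction l with
  | nil => simp
  | cons u l ih =>
    rw [List.prod_cons, Submonoid.coe_mul, mul_apply_eq_comp,
      ih fun v hv => h v (by simp [hv]), h u (by simp)]

end PartialMaps

/-! ### The null space of `T_inv` and rotational invariance -/

section Invariance

variable {m n : ℕ}

theorem isMwRI_iff (f : HilbertMN m n) :
    IsMwRI f ↔ ∀ (A : Matrix (Fin n) (Fin n) ℝ) (hA : Aᵀ = -A),
      (compUnitary (matRotation m A hA) : HilbertMN m n →L[ℂ] HilbertMN m n) f = f := by
  simp only [compUnitary_apply_eq_iff]
  rfl

/-- This is why the planes containing one fixed axis `l` suffice: their generators produce all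
others by commutators. -/
theorem rotationGenerator_commutator {j k l : Fin n} (hjk : j ≠ k) (hjl : j ≠ l) (hkl : k ≠ l) :
    rotationGenerator j l * rotationGenerator k l - rotationGenerator k l * rotationGenerator j l =
      rotationGenerator j k := by
  simp only [rotationGenerator, mul_sub, sub_mul]
  simp [hjk, hjl, hkl, hjk.symm, hjl.symm, hkl.symm]
  abel

/-- Each plane is counted for both orders of its indices with equal contributions, hence the factor
`1/2`. -/
theorem eq_sum_rotationGenerator {A : Matrix (Fin n) (Fin n) ℝ} (hA : Aᵀ = -A) :
    A = ∑ p : Fin n × Fin n, (A p.2 p.1 / 2) • rotationGenerator p.1 p.2 := by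
  ext a b
  have h : A b a = -A a b := congrFun (congrFun hA a) b
  simp only [rotationGenerator, Matrix.sum_apply, Matrix.smul_apply, Matrix.sub_apply,
    Matrix.single_apply, Fintype.sum_prod_type, smul_eq_mul, mul_sub, Finset.sum_sub_distrib]
  simp [ite_and, h]
  ring

/-- A vector that annihilates the ranges of the operators `v_{k,l}` with `k ≠ l`, for one `l`, is
invariant under all rotations. -/
theorem isMwRI_of_inner_eq_zero {f : HilbertMN m n} (l : Fin n)
    (h : ∀ k, k ≠ l → ∀ φ, inner ℂ f (schwartzToL2 m n
      (linearFieldDeriv (MatSpace.mulRightCLM m (rotationGenerator k l)) φ)) = 0) :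
    IsMwRI f := by
  have hgen : ∀ j k φ, inner ℂ f (schwartzToL2 m n
      (linearFieldDeriv (MatSpace.mulRightCLM m (rotationGenerator j k)) φ)) = 0 := by
    have hneg : ∀ (j k : Fin n) (φ : 𝓢(MatSpace m n, ℂ)),
        linearFieldDeriv (MatSpace.mulRightCLM m (rotationGenerator j k)) φ =
        -linearFieldDeriv (MatSpace.mulRightCLM m (rotationGenerator k j)) φ := by
      intro j k φ
      ext X
      have : rotationGenerator j k = 0 - rotationGenerator k j := by simp [rotationGenerator]
      rw [this, MatSpace.mulRightCLM_sub]
      have h0 : X.mulRight (0 : Matrix (Fin n) (Fin n) ℝ) = 0 := by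
        ext ⟨i, j⟩; simp [MatSpace.mulRight_apply]
      simp [linearFieldDeriv_apply, h0]
    have hdiag : ∀ (j : Fin n) (φ : 𝓢(MatSpace m n, ℂ)), inner ℂ f (schwartzToL2 m n
        (linearFieldDeriv (MatSpace.mulRightCLM m (rotationGenerator j j)) φ)) = 0 := by
      intro j φ
      rw [← self_eq_neg (G := ℂ), ← inner_neg_right, ← map_neg, ← hneg]
    intro j k φ
    by_cases hjl : j = l
    · subst hjl
      by_cases hkj : k = j
      · exact hkj ▸ hdiag k φ
      · rw [hneg, map_neg, inner_neg_right, h k hkj, neg_zero]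
    by_cases hkl : k = l
    · exact hkl ▸ h j hjl φ
    by_cases hjk : j = k
    · exact hjk ▸ hdiag j φ
    -- Both terms of the commutator lie in the images of the core under the fields for `(j,l)` and
    -- `(k,l)`, because these fields map Schwartz functions to Schwartz functions. No regularity of
    -- `f` is needed.
    rw [← rotationGenerator_commutator hjk hjl hkl, MatSpace.mulRightCLM_sub,
      ← MatSpace.mulRightCLM_comp, ← MatSpace.mulRightCLM_comp, ← linearFieldDeriv_commutator,
      map_sub, inner_sub_right, h j hjl, h k hkl, sub_zero]
  rw [isMwRI_iff]
  intro A hA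
  have hA' : ∀ φ, inner ℂ f (schwartzToL2 m n
      (linearFieldDeriv (MatSpace.mulRightCLM m A) φ)) = 0 := by
    intro φ
    rw [eq_sum_rotationGenerator hA, MatSpace.mulRightCLM_sum, linearFieldDeriv_sum, map_sum,
      inner_sum]
    refine Finset.sum_eq_zero fun p _ => ?_
    rw [map_smul, inner_smul_right, hgen, mul_zero]
  have h1 := (hasInvariantCore_rotationGroup hA).apply_eq_of_inner_eq_zero
    (isUnitaryGroup_rotationGroup hA) hA' 1
  simpa only [rotationGroup, one_smul] using h1

theorem IsMwRI.rotationGroup_apply {f : HilbertMN m n} (hf : IsMwRI f)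
    {A : Matrix (Fin n) (Fin n) ℝ} (hA : Aᵀ = -A) (t : ℝ) :
    (rotationGroup m A hA t : HilbertMN m n →L[ℂ] HilbertMN m n) f = f :=
  (isMwRI_iff f).1 hf _ _

theorem rOp_graph (hm : 1 ≤ m) (k : Fin (n - 1)) :
    (rOp m n k).graph = generatorGraph fun t => rotationGroup m
      (rotationGenerator ⟨k.1, by have := k.2; omega⟩ ⟨k.1 + 1, by have := k.2; omega⟩)
      (rotationGenerator_transpose _ _) (Real.arctan (Real.sqrt ((k : ℝ) + 1)) * t) := by
  refine IsUnitaryGroup.smul_graph_eq (vOp_graph hm _ _) ?_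
  have h : 0 < Real.arctan (Real.sqrt ((k : ℝ) + 1)) := by
    rw [Real.arctan_pos]
    positivity
  exact h.ne'

theorem IsMwRI.ROp_apply (hm : 1 ≤ m) {f : HilbertMN m n} (hf : IsMwRI f) :
    (ROp m n : HilbertMN m n →L[ℂ] HilbertMN m n) f = f := by
  refine unitary_list_prod_apply_eq fun u hu => ?_
  obtain ⟨k, rfl⟩ := (List.mem_ofFn' _ _).1 (List.mem_reverse.1 hu)
  beta_reduce
  rw [((isUnitaryGroup_rotationGroup _).comp_const_mul _).unitaryExp_eq (rOp_graph hm k)]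
  · exact hf.rotationGroup_apply _ _
  · exact dense_vOp_domain hm _ _

theorem IsMwRI.star_ROp_apply (hm : 1 ≤ m) {f : HilbertMN m n} (hf : IsMwRI f) :
    (star (ROp m n) : HilbertMN m n →L[ℂ] HilbertMN m n) f = f := by
  conv_lhs => rw [← hf.ROp_apply hm]
  exact unitary_star_apply_apply _ _

/-- Invariant vectors are annihilated by `T_inv`. -/
theorem IsMwRI.mem_nullSpace (hm : 1 ≤ m) {f : HilbertMN m n} (hf : IsMwRI f) :
    f ∈ nullSpace (TInv m n) := by
  have h : (f, ∑ _k : Fin (n - 1), (0 : HilbertMN m n)) ∈ (TInv m n).graph := by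
    refine LinearPMap.mem_graph_sum _ fun k _ => ?_
    have h0 : (f, 0) ∈ (vLast m n k).adjoint.graph := by
      refine LinearPMap.mem_graph_adjoint_zero (dense_vOp_domain hm _ _) fun g g' hg => ?_
      have hg' := (vOp_graph hm _ _).le hg
      exact inner_eq_zero_of_invariant (hf.rotationGroup_apply _) hg'
    have h1 := mem_graph_opComp (mem_graph_ofBounded.2 (hf.ROp_apply hm).symm) h0
    have h2 := mem_graph_opComp h1 (zero_mem (vLast m n k).graph)
    exact mem_graph_opComp h2 (mem_graph_ofBounded.2 (map_zero _).symm)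
  rw [Finset.sum_const_zero] at h
  obtain ⟨y, hy, hy0⟩ := (LinearPMap.mem_graph_iff _).1 h
  dsimp only at hy hy0
  subst hy
  exact ⟨y.2, hy0⟩

theorem nullSpace_subset_KSet : nullSpace (TInv m n) ⊆ KSet m n 0 := by
  rintro f ⟨h, h0⟩
  exact ⟨h, by simp [h0]⟩

/-- Moving `R^*` and `v_{k,n}` across the inner product writes `⟨f, T_inv f⟩` as a sum of the
squares `‖v_{k,n}^* R f‖²`, each of which must vanish. -/
theorem mem_graph_adjoint_vLast_of_mem_KSet (hm : 1 ≤ m) {f : HilbertMN m n} (hf : f ∈ KSet m n 0)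
    (k : Fin (n - 1)) :
    ((ROp m n : HilbertMN m n →L[ℂ] HilbertMN m n) f, 0) ∈ (vLast m n k).adjoint.graph := by
  obtain ⟨h, hle⟩ := hf
  have hd := (LinearPMap.mem_domain_sum _ _ _).1 h
  have hg : ∀ k : Fin (n - 1), ∃ y w,
      (f, y) ∈ (opComp (ofBounded (star (ROp m n) : HilbertMN m n →L[ℂ] HilbertMN m n))
        (opComp (vLast m n k) (opComp (vLast m n k).adjoint
          (ofBounded (ROp m n : HilbertMN m n →L[ℂ] HilbertMN m n))))).graph ∧
      ((ROp m n : HilbertMN m n →L[ℂ] HilbertMN m n) f, w) ∈ (vLast m n k).adjoint.graph ∧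
      (inner ℂ f y).re = ‖w‖ ^ 2 := by
    intro k
    have h1 := LinearPMap.mem_graph _ ⟨f, hd k (Finset.mem_univ k)⟩
    obtain ⟨z, hz, hy⟩ := exists_mem_graph_of_mem_graph_opComp h1
    obtain ⟨w, hw, hwz⟩ := exists_mem_graph_of_mem_graph_opComp hz
    obtain ⟨g, hfg, hgw⟩ := exists_mem_graph_of_mem_graph_opComp hw
    obtain rfl := mem_graph_ofBounded.1 hfg
    refine ⟨_, w, h1, hgw, ?_⟩
    rw [mem_graph_ofBounded.1 hy]
    have h2 := LinearPMap.inner_eq_of_mem_graph_adjoint (dense_vOp_domain hm _ _) hgw hwz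
    have h3 : inner ℂ f ((star (ROp m n) : HilbertMN m n →L[ℂ] HilbertMN m n) z) =
        inner ℂ ((ROp m n : HilbertMN m n →L[ℂ] HilbertMN m n) f) z :=
      ContinuousLinearMap.adjoint_inner_right _ _ _
    rw [h3, h2]
    exact inner_self_eq_norm_sq (𝕜 := ℂ) w
  choose y w hy hw hyw using hg
  have h1 := LinearPMap.mem_graph_sum Finset.univ fun k _ => hy k
  have h2 : TInv m n ⟨f, h⟩ = ∑ k, y k :=
    LinearPMap.mem_graph_snd_inj _ (LinearPMap.mem_graph (TInv m n) ⟨f, h⟩) h1 rfl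
  rw [h2, inner_sum, Complex.re_sum, zero_mul] at hle
  simp only [hyw] at hle
  have h3 := (Finset.sum_eq_zero_iff_of_nonneg fun k _ => sq_nonneg ‖w k‖).1
    (le_antisymm hle (Finset.sum_nonneg fun k _ => sq_nonneg ‖w k‖)) k (Finset.mem_univ k)
  have h4 : w k = 0 := by simpa using h3
  exact h4 ▸ hw k

theorem isMwRI_of_mem_KSet (hm : 1 ≤ m) (hn : 2 ≤ n) {f : HilbertMN m n} (hf : f ∈ KSet m n 0) :
    IsMwRI f := by
  have h : IsMwRI ((ROp m n : HilbertMN m n →L[ℂ] HilbertMN m n) f) := by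
    refine isMwRI_of_inner_eq_zero ⟨n - 1, by omega⟩ fun k hk φ => ?_
    have hk' : k.1 < n - 1 := by
      have := k.2
      have : k.1 ≠ n - 1 := fun h => hk (Fin.ext h)
      omega
    have h1 := mem_graph_adjoint_vLast_of_mem_KSet hm hf ⟨k.1, hk'⟩
    have h2 := (hasInvariantCore_rotationGroup (m := m)
      (rotationGenerator_transpose k ⟨n - 1, by omega⟩)).mem_graph φ
    rw [← vOp_graph hm] at h2
    rw [LinearPMap.inner_eq_of_mem_graph_adjoint (dense_vOp_domain hm _ _) h1 h2, inner_zero_left]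
  -- As `R f` is invariant, `R^*` fixes it; but `R^* R f = f`, so `f` is `R f` itself.
  have h1 := h.star_ROp_apply hm
  rw [unitary_star_apply_apply] at h1
  rwa [← h1] at h

end Invariance

/-! ### One row: invariant functions are radial -/

section Radial

variable {n : ℕ}

/-- A flow with the generator `D` acts as a rotation on a plane on which `D` is a quarter turn. -/
theorem IsIsometricFlow.apply_eq_cos_add_sin {E : Type*} [NormedAddCommGroup E]
    [InnerProductSpace ℝ E] {D : E →L[ℝ] E} {V : ℝ → E ≃ₗᵢ[ℝ] E} (hV : IsIsometricFlow D V) {X Z : E}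
    (hX : D X = Z) (hZ : D Z = -X) (t : ℝ) : V t X = Real.cos t • X + Real.sin t • Z := by
  -- Both sides solve the linear equation `x' = D x` with initial value `X`.
  refine congrFun (ODE_solution_unique_univ (v := fun _ => D) (s := fun _ => Set.univ) (t₀ := 0)
    (f := fun t => V t X) (g := fun t => Real.cos t • X + Real.sin t • Z)
    (fun _ => D.lipschitz.lipschitzOnWith) (fun t => ⟨hV.hasDerivAt X t, trivial⟩)
    (fun t => ⟨?_, trivial⟩) ?_) t
  · refine (((Real.hasDerivAt_cos t).smul_const X).add
      ((Real.hasDerivAt_sin t).smul_const Z)).congr_deriv ?_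
    rw [_root_.map_add, map_smul, map_smul, hX, hZ]
    module
  · simp [hV.map_zero]

/-- In dimension at least two, the rotations act transitively on the spheres. -/
theorem exists_mulRight_exp_eq (hn : 2 ≤ n) {X Y : MatSpace 1 n} (h : ‖X‖ = ‖Y‖) :
    ∃ A : Matrix (Fin n) (Fin n) ℝ, Aᵀ = -A ∧ X.mulRight (NormedSpace.exp A) = Y := by
  by_cases hX : X = 0
  · subst hX
    have hY : Y = 0 := by simpa using h.symm
    subst hY
    refine ⟨0, by simp, ?_⟩
    rw [NormedSpace.exp_zero, MatSpace.mulRight_one]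
  have hr : 0 < ‖X‖ := norm_pos_iff.2 hX
  -- an orthogonal vector whose span with `X` contains `Y`
  obtain ⟨W, c, d, hW, hXW, hYW⟩ : ∃ (W : MatSpace 1 n) (c d : ℝ), W ≠ 0 ∧ inner ℝ X W = 0 ∧
      Y = c • X + d • W := by
    set c : ℝ := inner ℝ X Y / ‖X‖ ^ 2
    by_cases hW : Y - c • X = 0
    · have h1 : (Submodule.span ℝ {X})ᗮ ≠ ⊥ := by
        intro h2
        have h3 := Submodule.finrank_add_finrank_orthogonal (Submodule.span ℝ {X})
        rw [h2, finrank_span_singleton hX, finrank_bot, finrank_euclideanSpace] at h3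
        simp at h3
        omega
      obtain ⟨W, hW1, hW2⟩ := Submodule.exists_mem_ne_zero_of_ne_bot h1
      refine ⟨W, c, 0, hW2, ?_, ?_⟩
      · exact Submodule.mem_orthogonal_singleton_iff_inner_right.1 hW1
      · simpa using sub_eq_zero.1 hW
    · refine ⟨Y - c • X, c, 1, hW, ?_, by simp⟩
      rw [inner_sub_right, inner_smul_right, real_inner_self_eq_norm_sq]
      simp only [c]
      field_simp
      ring
  have hw : 0 < ‖W‖ := norm_pos_iff.2 hW
  set Z : MatSpace 1 n := (‖X‖ / ‖W‖) • W with hZ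
  have hZn : ‖Z‖ = ‖X‖ := by
    rw [hZ, norm_smul, Real.norm_eq_abs, abs_of_pos (by positivity)]
    field_simp
  have hXZ : inner ℝ X Z = 0 := by rw [hZ, inner_smul_right, hXW, mul_zero]
  obtain ⟨s, hYZ⟩ : ∃ s : ℝ, Y = c • X + s • Z :=
    ⟨d * (‖W‖ / ‖X‖), by rw [hZ, smul_smul, hYW]; congr 2; field_simp⟩
  have hcs : c ^ 2 + s ^ 2 = 1 := by
    have h1 : ‖Y‖ ^ 2 = (c ^ 2 + s ^ 2) * ‖X‖ ^ 2 := by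
      rw [hYZ, norm_add_sq_real, inner_smul_left, inner_smul_right, hXZ, norm_smul, norm_smul, hZn,
        mul_pow, mul_pow, Real.norm_eq_abs, Real.norm_eq_abs, sq_abs, sq_abs]
      simp
      ring
    rw [← h] at h1
    have h2 : ‖X‖ ^ 2 ≠ 0 := by positivity
    field_simp at h1
    linarith
  obtain ⟨θ, hc, hs⟩ : ∃ θ : ℝ, Real.cos θ = c ∧ Real.sin θ = s := by
    have h1 : ‖(⟨c, s⟩ : ℂ)‖ = 1 := by
      rw [Complex.norm_eq_sqrt_sq_add_sq, hcs, Real.sqrt_one]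
    have h2 : (⟨c, s⟩ : ℂ) ≠ 0 := by
      intro h3; rw [h3] at h1; simp at h1
    exact ⟨Complex.arg ⟨c, s⟩, by rw [Complex.cos_arg h2, h1]; simp,
      by rw [Complex.sin_arg, h1]; simp⟩
  -- The antisymmetric matrix with `X J = Z` and `Z J = -X`: a quarter turn in the plane of `X` and
  -- `Z`, zero on its orthogonal complement.
  set J : Matrix (Fin n) (Fin n) ℝ := Matrix.of fun a b =>
    (X (0, a) * Z (0, b) - Z (0, a) * X (0, b)) / ‖X‖ ^ 2 with hJ
  have hJt : Jᵀ = -J := by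
    ext a b
    simp only [hJ, Matrix.transpose_apply, Matrix.of_apply, Matrix.neg_apply]
    ring
  have hin : ∀ V W : MatSpace 1 n, inner ℝ V W = ∑ a, V (0, a) * W (0, a) := by
    intro V W
    rw [PiLp.inner_apply, Fintype.sum_prod_type]
    simp [mul_comm]
  have hmul : ∀ V : MatSpace 1 n, V.mulRight J =
      (inner ℝ V X / ‖X‖ ^ 2) • Z - (inner ℝ V Z / ‖X‖ ^ 2) • X := by
    intro V
    ext ⟨i, b⟩
    obtain rfl : i = 0 := Subsingleton.elim _ _
    simp only [MatSpace.mulRight_apply, hJ, Matrix.of_apply, hin, PiLp.sub_apply, PiLp.smul_apply,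
      smul_eq_mul, Finset.sum_div, Finset.sum_mul, ← Finset.sum_sub_distrib]
    refine Finset.sum_congr rfl fun a _ => ?_
    ring
  have hr2 : ‖X‖ ^ 2 ≠ 0 := by positivity
  have h1 := (isIsometricFlow_matRotation (m := 1) hJt).apply_eq_cos_add_sin (X := X) (Z := Z)
    (by rw [MatSpace.mulRightCLM_apply, hmul, real_inner_self_eq_norm_sq, hXZ, div_self hr2]; simp)
    (by rw [MatSpace.mulRightCLM_apply, hmul, real_inner_self_eq_norm_sq, real_inner_comm, hXZ, hZn,
          div_self hr2]; simp) θ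
  refine ⟨θ • J, Matrix.transpose_smul_eq_neg hJt θ, ?_⟩
  rw [hYZ, ← hc, ← hs]
  exact h1

/-- The averages over balls of a function that is invariant under a linear isometry are
invariant. -/
theorem setAverage_closedBall_apply {E : Type*} [NormedAddCommGroup E] [InnerProductSpace ℝ E]
    [FiniteDimensional ℝ E] [MeasurableSpace E] [BorelSpace E] (e : E ≃ₗᵢ[ℝ] E) {f : E → ℂ}
    (hf : ∀ᵐ X, f X = f (e X)) (X : E) (r : ℝ) :
    ⨍ Y in Metric.closedBall (e X) r, f Y = ⨍ Y in Metric.closedBall X r, f Y := by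
  have hp : e ⁻¹' Metric.closedBall (e X) r = Metric.closedBall X r := by
    simp
  have hm := e.measurePreserving
  have h1 : volume (Metric.closedBall (e X) r) = volume (Metric.closedBall X r) := by
    rw [← hp, hm.measure_preimage measurableSet_closedBall.nullMeasurableSet]
  have h2 : ∫ Y in Metric.closedBall (e X) r, f Y = ∫ Y in Metric.closedBall X r, f Y := by
    rw [← hm.setIntegral_preimage_emb e.toHomeomorph.measurableEmbedding, hp]
    exact integral_congr_ae (ae_restrict_of_ae (hf.mono fun Y h => h.symm))
  rw [setAverage_eq, setAverage_eq, h2, measureReal_def, measureReal_def, h1]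

/-- The exceptional null set in the invariance of `f` depends on the rotation, so points of a sphere
cannot be compared directly. Ball averages do not see null sets and depend only on the norm of the
centre. -/
theorem isMwRI_iff_isRadial (hn : 2 ≤ n) (f : HilbertMN 1 n) : IsMwRI f ↔ IsRadial f := by
  constructor
  · intro hf
    have hloc : LocallyIntegrable f (volume : Measure (MatSpace 1 n)) :=
      (Lp.memLp f).locallyIntegrable one_le_two
    set a : MatSpace 1 n → ℝ → ℂ := fun X r => ⨍ Y in Metric.closedBall X r, f Y with ha
    have h1 : ∀ᵐ X : MatSpace 1 n, Filter.Tendsto (a X) (nhdsWithin 0 (Set.Ioi 0)) (nhds (f X)) := by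
      filter_upwards [(Besicovitch.vitaliFamily (volume : Measure (MatSpace 1 n))).ae_tendsto_average
        hloc] with X hX
      exact hX.comp (Besicovitch.tendsto_filterAt volume X)
    have h2 : ∀ X Y : MatSpace 1 n, ‖X‖ = ‖Y‖ → a X = a Y := by
      intro X Y hXY
      obtain ⟨A, hA, rfl⟩ := exists_mulRight_exp_eq hn hXY
      funext r
      exact (setAverage_closedBall_apply (matRotation 1 A hA) (hf A hA) X r).symm
    let e : MatSpace 1 n := EuclideanSpace.single (0, ⟨0, by omega⟩) 1
    have he : ‖e‖ = 1 := by simp [e]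
    -- The radial profile is the limit of ball averages along the ray through `e`. At almost every
    -- `X` the averages converge to `f X`, and there `limUnder` is a genuine limit.
    refine ⟨fun r => Filter.limUnder (nhdsWithin 0 (Set.Ioi 0)) (a (r • e)), h1.mono fun X hX => ?_⟩
    beta_reduce
    rw [h2 (‖X‖ • e) X (by rw [norm_smul, he, mul_one, norm_norm])]
    exact hX.limUnder_eq.symm
  · rintro ⟨g, hg⟩ A hA
    have h1 := (matRotation 1 A hA).measurePreserving.quasiMeasurePreserving.ae hg
    filter_upwards [hg, h1] with X hX hX'
    rw [hX]
    rw [LinearIsometryEquiv.norm_map] at hX'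
    exact hX'.symm

end Radial

end

theorem mainTheorem5 (m n : ℕ) (hm : 1 ≤ m) (hn : 2 ≤ n) :
    (∀ k : Fin (n - 1), ∃ U : ℝ → unitary (HilbertMN m n →L[ℂ] HilbertMN m n),
      IsUnitaryGroupOf (rOp m n k) U) ∧
    KSet m n 0 = nullSpace (TInv m n) ∧
    KSet m n 0 = {f : HilbertMN m n | IsMwRI f} ∧
    (m = 1 → KSet m n 0 = {f : HilbertMN m n | IsRadial f}) := by
  refine ⟨fun k => ⟨_, ((isUnitaryGroup_rotationGroup _).comp_const_mul _).isUnitaryGroupOf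
    (rOp_graph hm k)⟩, ?_, ?_, ?_⟩
  · exact Set.Subset.antisymm (fun f hf => (isMwRI_of_mem_KSet hm hn hf).mem_nullSpace hm)
      nullSpace_subset_KSet
  · exact Set.Subset.antisymm (fun f hf => isMwRI_of_mem_KSet hm hn hf)
      fun f hf => nullSpace_subset_KSet (IsMwRI.mem_nullSpace hm hf)
  · rintro rfl
    refine Set.Subset.antisymm
      (fun f hf => (isMwRI_iff_isRadial hn f).1 (isMwRI_of_mem_KSet hm hn hf)) fun f hf => ?_
    exact nullSpace_subset_KSet (((isMwRI_iff_isRadial hn f).2 hf).mem_nullSpace hm)
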